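/- Let $(\Omega,\mathcal F,\mathbb P)$ be an atomless probability space, $\mathcal L_1$ the set of random variables on it with values in $[0,1]$, and $\mathcal L^\infty$ the set of bounded random variables. Let $h:[0,1]\to\mathbb R$ be increasing (in the non-strict sense) with $h(0)=0$ and $h(1)=1$, and let $\rho:\mathcal L^\infty\to\mathbb R$ be the distortion risk measure with distortion function $h$, $$\rho(X)=\int_0^\infty h(\mathbb P(X>x))\,\mathrm dx+\int_{-\infty}^0\big(h(\mathbb P(X>x))-1\big)\,\mathrm dx .$$ Assume that $\rho$ satisfies [LS] $\liminf_{\ell\to\infty}\rho(X_\ell)\ge\rho(X)$ whenever $X,X_1,X_2,\dots\in\mathcal L_1$ and $X_\ell\to X$ almost surely. (This holds in particular if the same is true for sequences and limits in $\mathcal L^\infty$.) A sequence $(L_\ell)_{\ell\ge1}$ of random variables is called conditionally iid if there is a (finite-dimensional) random vector $Z$ such that, given $Z$, the $L_\ell$ are independent and identically distributed; write $L^{(\ell)}=(L_1+\cdots+L_\ell)/\ell$. For $X,Y\in\mathcal L^\infty$ write $X\le_{\rm icx}Y$ if $\mathbb E[\phi(X)]\le\mathbb E[\phi(Y)]$ for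 every increasing convex $\phi:\mathbb R\to\mathbb R$. Then the following are equivalent: 1. [PE] For every conditionally iid sequence $(L_\ell)_{\ell\ge1}$ in $\mathcal L_1$, all $1\le\ell\le\ell'$ and all $K\in[0,1)$, $$\rho\!\left(\frac{(L^{(\ell)}-K)_+}{1-K}\right)\ge\rho\!\left(\frac{(L^{(\ell')}-K)_+}{1-K}\right).$$ 2. [PE*] The same with $K=0$ only, that is, $\rho(L^{(\ell)})\ge\rho(L^{(\ell')})$ for every conditionally iid sequence in $\mathcal L_1$ and all $1\le\ell\le\ell'$. 3. [RA] $\rho(X)\le\rho(Y)$ for all $X,Y\in\mathcal L_1$ with $X\le_{\rm icx}Y$. 4. [RA] on $\mathcal L^\infty$: $\rho(X)\le\rho(Y)$ for all $X,Y\in\mathcal L^\infty$ with $X\le_{\rm icx}Y$. 5. [QC] $\rho(\lambda X+(1-\lambda)Y)\le\max\{\rho(X),\rho(Y)\}$ for all $X,Y\in\mathcal L_1$ and $\lambda\in[0,1]$. 6. [QC] on $\mathcal L^\infty$: the inequality in 5 holds for all $X,Y\in\mathcal L^\infty$ and $\lambda\in[0,1]$. 7. $h$ is concave on $[0,1]$.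 -/

import Mathlib

open MeasureTheory ProbabilityTheory Filter Set

namespace DistortionRisk

noncomputable section

/-- A probability measure is atomless if every event of positive probability contains an event of
strictly smaller positive probability. -/
def Atomless {Ω : Type*} [MeasurableSpace Ω] (P : Measure Ω) : Prop :=
  ∀ A : Set Ω, MeasurableSet A → 0 < P A → ∃ B ⊆ A, MeasurableSet B ∧ 0 < P B ∧ P B < P A

/-- The set of losses: random variables with values in the interval `[0, 1]`. -/
def LossSpace (Ω : Type*) [MeasurableSpace Ω] : Set (Ω → ℝ) :=
  {X | Measurable X ∧ ∀ ω, X ω ∈ Icc (0 : ℝ) 1}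

/-- The set of all bounded random variables. -/
def BoundedRV (Ω : Type*) [MeasurableSpace Ω] : Set (Ω → ℝ) :=
  {X | Measurable X ∧ ∃ C : ℝ, ∀ ω, |X ω| ≤ C}

/-- The Choquet integral `∫₀^∞ ν(X > x) dx + ∫_{-∞}^0 (ν(X > x) - 1) dx` of `X` with respect to a
set function `ν`. -/
def choquetIntegral {Ω : Type*} (ν : Set Ω → ℝ) (X : Ω → ℝ) : ℝ :=
  (∫ x in Ioi (0 : ℝ), ν {ω | x < X ω}) + ∫ x in Iio (0 : ℝ), (ν {ω | x < X ω} - 1)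

/-- A distortion function: increasing on `[0, 1]`, with `h 0 = 0` and `h 1 = 1`. Only its values on
`[0, 1]` matter. -/
structure IsDistortionFunction (h : ℝ → ℝ) : Prop where
  mono : MonotoneOn h (Icc 0 1)
  zero : h 0 = 0
  one : h 1 = 1

/-- `ρ` is the distortion risk measure with distortion function `h`: on bounded random variables it
is the Choquet integral with respect to the capacity `A ↦ h (P A)`. The values of `ρ` at functions
that are not bounded random variables play no role anywhere. -/
structure IsDistortionRiskMeasure {Ω : Type*} [MeasurableSpace Ω] (P : Measure Ω)
    (h : ℝ → ℝ) (ρ : (Ω → ℝ) → ℝ) : Prop where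
  isDistortion : IsDistortionFunction h
  eq_choquet : ∀ X ∈ BoundedRV Ω, ρ X = choquetIntegral (fun A => h (P.real A)) X

/-- [LS] on a domain `D` of random variables: lower semicontinuity under almost sure convergence.
The lower limit is taken in the extended reals. -/
def LowerSemicontAS {Ω : Type*} [MeasurableSpace Ω] (P : Measure Ω) (D : Set (Ω → ℝ))
    (ρ : (Ω → ℝ) → ℝ) : Prop :=
  ∀ (X : ℕ → Ω → ℝ) (Y : Ω → ℝ), (∀ n, X n ∈ D) → Y ∈ D →
    (∀ᵐ ω ∂P, Tendsto (fun n => X n ω) atTop (nhds (Y ω))) →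
      ((ρ Y : ℝ) : EReal) ≤ liminf (fun n => ((ρ (X n) : ℝ) : EReal)) atTop

/-- The sequence `L` is conditionally iid given the σ-algebra `m`: for all Borel sets, the
conditional probabilities given `m` factorize over finitely many indices, and they do not depend on
the index. -/
structure CondIIDGiven {Ω : Type*} [MeasurableSpace Ω] (P : Measure Ω) (m : MeasurableSpace Ω)
    (L : ℕ → Ω → ℝ) : Prop where
  indep : ∀ (s : Finset ℕ) (B : ℕ → Set ℝ), (∀ i, MeasurableSet (B i)) →
    P⟦⋂ i ∈ s, L i ⁻¹' B i | m⟧ =ᵐ[P] ∏ i ∈ s, P⟦L i ⁻¹' B i | m⟧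
  identDistrib : ∀ (i j : ℕ) (B : Set ℝ), MeasurableSet B →
    P⟦L i ⁻¹' B | m⟧ =ᵐ[P] P⟦L j ⁻¹' B | m⟧

/-- The sequence `L` is conditionally iid: it is conditionally iid given some random vector `Z`. -/
def CondIID {Ω : Type*} [MeasurableSpace Ω] (P : Measure Ω) (L : ℕ → Ω → ℝ) : Prop :=
  ∃ (d : ℕ) (Z : Ω → Fin d → ℝ), Measurable Z ∧
    CondIIDGiven P (MeasurableSpace.comap Z inferInstance) L

/-- The standardized portfolio loss of the first `n` assets (sequences are indexed from `0`). -/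
def poolLoss {Ω : Type*} (L : ℕ → Ω → ℝ) (n : ℕ) : Ω → ℝ :=
  fun ω => (∑ i ∈ Finset.range n, L i ω) / n

/-- The normalized loss `(X - K)₊ / (1 - K)` of the senior tranche with attachment point `K`. -/
def seniorTranche {Ω : Type*} (X : Ω → ℝ) (K : ℝ) : Ω → ℝ :=
  fun ω => max (X ω - K) 0 / (1 - K)

/-- Pooling effect consistency at a given attachment point `K`. -/
def PoolingAt {Ω : Type*} [MeasurableSpace Ω] (P : Measure Ω) (ρ : (Ω → ℝ) → ℝ) (K : ℝ) : Prop :=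
  ∀ L : ℕ → Ω → ℝ, (∀ i, L i ∈ LossSpace Ω) → CondIID P L →
    ∀ n n' : ℕ, 1 ≤ n → n ≤ n' →
      ρ (seniorTranche (poolLoss L n') K) ≤ ρ (seniorTranche (poolLoss L n) K)

/-- [PE]: pooling effect consistency, for all attachment points `K ∈ [0, 1)`. -/
def PE {Ω : Type*} [MeasurableSpace Ω] (P : Measure Ω) (ρ : (Ω → ℝ) → ℝ) : Prop :=
  ∀ K ∈ Ico (0 : ℝ) 1, PoolingAt P ρ K

/-- [PE*]: pooling effect consistency with only `K = 0`. -/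
def PEStar {Ω : Type*} [MeasurableSpace Ω] (P : Measure Ω) (ρ : (Ω → ℝ) → ℝ) : Prop :=
  PoolingAt P ρ 0

/-- Increasing convex order, for bounded random variables. -/
def IcxLE {Ω : Type*} [MeasurableSpace Ω] (P : Measure Ω) (X Y : Ω → ℝ) : Prop :=
  ∀ φ : ℝ → ℝ, Monotone φ → ConvexOn ℝ univ φ → ∫ ω, φ (X ω) ∂P ≤ ∫ ω, φ (Y ω) ∂P

/-- [RA] on a domain `D` of random variables: risk aversion consistency. -/
def RA {Ω : Type*} [MeasurableSpace Ω] (P : Measure Ω) (D : Set (Ω → ℝ))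
    (ρ : (Ω → ℝ) → ℝ) : Prop :=
  ∀ X ∈ D, ∀ Y ∈ D, IcxLE P X Y → ρ X ≤ ρ Y

/-- [QC] on a domain `D` of random variables: quasi-convexity. -/
def QC {Ω : Type*} (D : Set (Ω → ℝ)) (ρ : (Ω → ℝ) → ℝ) : Prop :=
  ∀ X ∈ D, ∀ Y ∈ D, ∀ t ∈ Icc (0 : ℝ) 1,
    ρ (fun ω => t * X ω + (1 - t) * Y ω) ≤ max (ρ X) (ρ Y)

end

end DistortionRisk

open DistortionRisk

/-! Sufficiency of concavity rests on the building blocks `min (survival) α`. Their integral is the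
minimum over `c` of `α (c - m) + E (X - c)₊`, attained at a quantile (`integral_min_survival_le`,
`exists_integral_min_survival_eq`). It is therefore monotone in the increasing convex order and,
since `(x - c)₊` is jointly convex in `(x, c)`, convex in `X`. A concave `h` is a pointwise limit of
piecewise linear interpolants whose slopes decrease, and summation by parts turns these into
nonnegative combinations of the blocks. Both properties thus pass to `ρ`
(`integral_concave_survival_le_combination`).

Risk aversion gives pooling consistency because a conditionally iid sequence is exchangeable: the
mean of `n + 1` losses is the average of its leave-one-out means, each distributed like the mean of
`n` losses, so Jensen applies (`CondIID.icxLE_poolLoss_succ`).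

Necessity of concavity uses one example (`le_of_poolLoss_le`). The loss is 1 in a bad state of
probability `a`, an independent Bernoulli(`p`) variable in a medium state of probability `b - a`,
and 0 otherwise. A single loss has risk `h (p b + (1 - p) a)`. By the strong law the pool tends to a
variable equal to 1, `p` or 0, of risk `p h b + (1 - p) h a`. If pooling never raises the risk,
lower semicontinuity gives the concavity inequality. Both [PE*] and [QC] on `LossSpace Ω` bound the
pool risk here. The independent events come from Sierpiński's theorem (`Atomless.exists_iIndepSet`).
-/

namespace DistortionRisk

open Topology ENNReal

/-! ### Survival functions, stop-loss transforms and truncated survival integrals. -/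

section Survival

variable {Ω : Type*} [MeasurableSpace Ω] {P : Measure Ω}

/-- The survival function of a random variable. -/
noncomputable def survival (P : Measure Ω) (X : Ω → ℝ) (x : ℝ) : ℝ := P.real {ω | x < X ω}

lemma survival_antitone [IsFiniteMeasure P] (X : Ω → ℝ) : Antitone (survival P X) := fun _ _ hxy =>
  measureReal_mono fun _ hω => lt_of_le_of_lt hxy hω

lemma survival_of_ge {X : Ω → ℝ} {M x : ℝ} (hX : ∀ ω, X ω ≤ M) (hx : M ≤ x) :
    survival P X x = 0 := by
  have : {ω | x < X ω} = ∅ := eq_empty_of_forall_notMem fun ω h =>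
    absurd (lt_of_lt_of_le h (hX ω)) (not_lt.2 hx)
  simp [survival, this]

variable [IsProbabilityMeasure P]

lemma survival_mem (X : Ω → ℝ) (x : ℝ) : survival P X x ∈ Icc (0 : ℝ) 1 :=
  ⟨measureReal_nonneg, measureReal_le_one⟩

lemma survival_of_lt {X : Ω → ℝ} {m x : ℝ} (hX : ∀ ω, m ≤ X ω) (hx : x < m) :
    survival P X x = 1 := by
  have : {ω | x < X ω} = univ := eq_univ_of_forall fun ω => lt_of_lt_of_le hx (hX ω)
  simp [survival, this]

lemma antitone_comp_survival {g : ℝ → ℝ} (hg : MonotoneOn g (Icc 0 1)) (X : Ω → ℝ) :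
    Antitone fun x => g (survival P X x) := fun _ _ hxy =>
  hg (survival_mem X _) (survival_mem X _) (survival_antitone X hxy)

lemma intervalIntegrable_comp_survival {g : ℝ → ℝ} (hg : MonotoneOn g (Icc 0 1)) (X : Ω → ℝ)
    (a b : ℝ) : IntervalIntegrable (fun x => g (survival P X x)) volume a b :=
  (antitone_comp_survival hg X).intervalIntegrable

/-- Both integrands vanish outside `[m, M]`, because the survival function is 0 from `M` on and 1
below `m`. The summand `m` is the integral of `-1` over `[m, 0]`. -/
lemma choquetIntegral_eq {h : ℝ → ℝ} (hh : IsDistortionFunction h) {X : Ω → ℝ} {m M : ℝ}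
    (hm : m ≤ 0) (hM : 0 ≤ M) (hX : ∀ ω, X ω ∈ Icc m M) :
    choquetIntegral (fun A => h (P.real A)) X = m + ∫ x in m..M, h (survival P X x) := by
  have h1 : (∫ x in Ioi (0 : ℝ), h (survival P X x)) = ∫ x in (0)..M, h (survival P X x) := by
    rw [intervalIntegral.integral_of_le hM]
    refine setIntegral_eq_of_subset_of_forall_sdiff_eq_zero measurableSet_Ioi
      (fun x hx => hx.1) fun x hx => ?_
    have hx' : M ≤ x := by
      by_contra hlt
      exact hx.2 ⟨hx.1, (not_le.1 hlt).le⟩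
    rw [survival_of_ge (fun ω => (hX ω).2) hx', hh.zero]
  have h2 : (∫ x in Iio (0 : ℝ), (h (survival P X x) - 1))
      = ∫ x in m..0, (h (survival P X x) - 1) := by
    rw [intervalIntegral.integral_of_le hm, ← integral_Ico_eq_integral_Ioc]
    refine setIntegral_eq_of_subset_of_forall_sdiff_eq_zero measurableSet_Iio
      (fun x hx => hx.2) fun x hx => ?_
    have hx' : x < m := by
      by_contra hlt
      exact hx.2 ⟨not_lt.1 hlt, hx.1⟩
    rw [survival_of_lt (fun ω => (hX ω).1) hx', hh.one, sub_self]
  have h3 := intervalIntegral.integral_sub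
    (intervalIntegrable_comp_survival (P := P) hh.mono X m 0)
    (intervalIntegrable_const (c := (1 : ℝ)))
  have h4 := intervalIntegral.integral_add_adjacent_intervals
    (intervalIntegrable_comp_survival (P := P) hh.mono X m 0)
    (intervalIntegrable_comp_survival hh.mono X 0 M)
  unfold choquetIntegral
  change (∫ x in Ioi (0 : ℝ), h (survival P X x)) + ∫ x in Iio (0 : ℝ), (h (survival P X x) - 1) = _
  rw [h1, h2, h3, ← h4, intervalIntegral.integral_const]
  simp only [smul_eq_mul]
  ring

lemma integrable_max_sub {X : Ω → ℝ} (hXm : Measurable X) {m M : ℝ} (hX : ∀ ω, X ω ∈ Icc m M)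
    (c : ℝ) : Integrable (fun ω => max (X ω - c) 0) P := by
  refine Integrable.of_bound (C := max (M - c) 0) (by fun_prop) (Eventually.of_forall fun ω => ?_)
  rw [Real.norm_eq_abs, abs_of_nonneg (le_max_right _ _)]
  exact max_le_max_right 0 (sub_le_sub_right (hX ω).2 c)

/-- The stop-loss transform is the integrated survival function. -/
lemma integral_max_sub {X : Ω → ℝ} (hXm : Measurable X) {m M : ℝ} (hX : ∀ ω, X ω ∈ Icc m M)
    {c : ℝ} (hc : c ≤ M) :
    ∫ ω, max (X ω - c) 0 ∂P = ∫ x in c..M, survival P X x := by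
  rw [(integrable_max_sub hXm hX c).integral_eq_integral_meas_lt
    (Eventually.of_forall fun ω => le_max_right _ _)]
  have h1 : ∀ t ∈ Ioi (0 : ℝ), P.real {ω | t < max (X ω - c) 0} = survival P X (t + c) := by
    intro t ht
    unfold survival
    congr 1
    ext ω
    simp only [mem_ofPred_eq, lt_max_iff, not_lt.2 (le_of_lt (mem_Ioi.1 ht)), or_false]
    exact lt_sub_iff_add_lt
  rw [setIntegral_congr_fun measurableSet_Ioi h1]
  have h2 : ∫ t in Ioi (0 : ℝ), survival P X (t + c) = ∫ t in (0)..(M - c), survival P X (t + c) := by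
    rw [intervalIntegral.integral_of_le (sub_nonneg.2 hc)]
    refine setIntegral_eq_of_subset_of_forall_sdiff_eq_zero measurableSet_Ioi
      (fun x hx => hx.1) fun x hx => ?_
    have hx' : M - c ≤ x := by
      by_contra hlt
      exact hx.2 ⟨hx.1, (not_le.1 hlt).le⟩
    exact survival_of_ge (fun ω => (hX ω).2) (by linarith)
  rw [h2, intervalIntegral.integral_comp_add_right (fun x => survival P X x)]
  simp

lemma monotoneOn_min (α : ℝ) (s : Set ℝ) : MonotoneOn (fun y => min y α) s :=
  fun _ _ _ _ hxy => min_le_min_right α hxy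

/-- Split at `c`, bounding the minimum by `α` to the left and by the survival function to the right.
-/
lemma integral_min_survival_le {X : Ω → ℝ} (hXm : Measurable X) {m M : ℝ}
    (hX : ∀ ω, X ω ∈ Icc m M) (α : ℝ) {c : ℝ} (hc : c ∈ Icc m M) :
    ∫ x in m..M, min (survival P X x) α ≤ α * (c - m) + ∫ ω, max (X ω - c) 0 ∂P := by
  have hi := fun a b => intervalIntegrable_comp_survival (P := P) (monotoneOn_min α _) X a b
  rw [integral_max_sub hXm hX hc.2,
    ← intervalIntegral.integral_add_adjacent_intervals (hi m c) (hi c M)]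
  refine add_le_add ?_ ?_
  · refine (intervalIntegral.integral_mono_on hc.1 (hi m c) (intervalIntegrable_const (c := α))
      fun x _ => min_le_right _ _).trans_eq ?_
    simp [mul_comm]
  · exact intervalIntegral.integral_mono_on hc.2 (hi c M)
      (survival_antitone X).intervalIntegrable fun x _ => min_le_left _ _

/-- The optimal `c` is a quantile, the point where the survival function drops to `α`: both bounds
of the preceding lemma are then equalities. -/
lemma exists_integral_min_survival_eq {X : Ω → ℝ} (hXm : Measurable X) {m M : ℝ} (hmM : m ≤ M)
    (hX : ∀ ω, X ω ∈ Icc m M) {α : ℝ} (hα : 0 ≤ α) :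
    ∃ c ∈ Icc m M,
      ∫ x in m..M, min (survival P X x) α = α * (c - m) + ∫ ω, max (X ω - c) 0 ∂P := by
  set A : Set ℝ := {x ∈ Icc m M | survival P X x ≤ α} with hA
  have hMA : M ∈ A := ⟨⟨hmM, le_rfl⟩, by rwa [survival_of_ge (fun ω => (hX ω).2) le_rfl]⟩
  have hbdd : BddBelow A := ⟨m, fun x hx => hx.1.1⟩
  have hc : sInf A ∈ Icc m M := ⟨le_csInf ⟨M, hMA⟩ fun x hx => hx.1.1, csInf_le hbdd hMA⟩
  refine ⟨sInf A, hc, ?_⟩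
  set c := sInf A
  have hi := fun a b => intervalIntegrable_comp_survival (P := P) (monotoneOn_min α _) X a b
  rw [integral_max_sub hXm hX hc.2,
    ← intervalIntegral.integral_add_adjacent_intervals (hi m c) (hi c M)]
  congr 1
  · have : ∫ x in m..c, min (survival P X x) α = ∫ x in m..c, α := by
      -- The half-open interval omits `c` itself, where the survival function may already be at most
      -- `α`.
      rw [intervalIntegral.integral_of_le hc.1, intervalIntegral.integral_of_le hc.1,
        ← integral_Ico_eq_integral_Ioc, ← integral_Ico_eq_integral_Ioc]
      refine setIntegral_congr_fun measurableSet_Ico fun x hx => min_eq_right ?_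
      by_contra hlt
      exact absurd (csInf_le hbdd ⟨⟨hx.1, hx.2.le.trans hc.2⟩, (not_le.1 hlt).le⟩) (not_le.2 hx.2)
    rw [this]
    simp [mul_comm]
  · rw [intervalIntegral.integral_of_le hc.2, intervalIntegral.integral_of_le hc.2]
    refine setIntegral_congr_fun measurableSet_Ioc fun x hx => min_eq_left ?_
    obtain ⟨y, hy, hyx⟩ := exists_lt_of_csInf_lt ⟨M, hMA⟩ hx.1
    exact (survival_antitone X hyx.le).trans hy.2

/-- Joint convexity of stop-loss transforms passes to the integrals of `min (survival) α`. -/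
lemma integral_min_survival_le_combination {W X Y : Ω → ℝ} (hW : Measurable W) (hX : Measurable X)
    (hY : Measurable Y) {m M : ℝ} (hmM : m ≤ M) (hW' : ∀ ω, W ω ∈ Icc m M)
    (hX' : ∀ ω, X ω ∈ Icc m M) (hY' : ∀ ω, Y ω ∈ Icc m M) {t : ℝ} (ht : t ∈ Icc (0 : ℝ) 1)
    (hle : ∀ c d : ℝ, ∫ ω, max (W ω - (t * c + (1 - t) * d)) 0 ∂P
      ≤ t * ∫ ω, max (X ω - c) 0 ∂P + (1 - t) * ∫ ω, max (Y ω - d) 0 ∂P)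
    {α : ℝ} (hα : 0 ≤ α) :
    ∫ x in m..M, min (survival P W x) α ≤ t * (∫ x in m..M, min (survival P X x) α)
      + (1 - t) * ∫ x in m..M, min (survival P Y x) α := by
  obtain ⟨c, hc, hc'⟩ := exists_integral_min_survival_eq (P := P) hX hmM hX' hα
  obtain ⟨d, hd, hd'⟩ := exists_integral_min_survival_eq (P := P) hY hmM hY' hα
  -- For `W` any threshold gives an upper bound, so the combination of the two optimal thresholds
  -- may be used.
  have hcd : t * c + (1 - t) * d ∈ Icc m M :=
    (convex_Icc m M) hc hd ht.1 (sub_nonneg.2 ht.2) (by ring)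
  refine (integral_min_survival_le hW hW' α hcd).trans ?_
  rw [hc', hd']
  linarith [hle c d]

end Survival

/-! ### Piecewise linear interpolation of a concave function. -/

section Interpolation

/-- Piecewise linear interpolation of `h` at the points `k / n`. -/
noncomputable def gridInterp (h : ℝ → ℝ) (n : ℕ) (x : ℝ) : ℝ :=
  ∑ k ∈ Finset.range n, (h ((k + 1 : ℕ) / n) - h (k / n)) *
    (n * min x ((k + 1 : ℕ) / n) - n * min x (k / n))

variable {h : ℝ → ℝ}

lemma grid_mem {n k : ℕ} (hk : k ≤ n) : (k / n : ℝ) ∈ Icc (0 : ℝ) 1 := by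
  refine ⟨by positivity, div_le_one_of_le₀ (by exact_mod_cast hk) (by positivity)⟩

lemma grid_increment_nonneg (hh : MonotoneOn h (Icc 0 1)) {n k : ℕ} (hk : k < n) :
    0 ≤ h ((k + 1 : ℕ) / n) - h (k / n) :=
  sub_nonneg.2 (hh (grid_mem hk.le) (grid_mem hk) (by gcongr; simp))

/-- Midpoint concavity at three consecutive grid points. -/
lemma grid_increment_antitone (hh : ConcaveOn ℝ (Icc 0 1) h) {n k : ℕ} (hk : k + 1 < n) :
    h ((k + 1 + 1 : ℕ) / n) - h ((k + 1 : ℕ) / n) ≤ h ((k + 1 : ℕ) / n) - h (k / n) := by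
  have h1 := hh.2 (grid_mem (show k ≤ n by omega)) (grid_mem (show k + 1 + 1 ≤ n by omega))
    (show (0 : ℝ) ≤ 1 / 2 by norm_num) (show (0 : ℝ) ≤ 1 / 2 by norm_num) (by norm_num)
  have h2 : (1 / 2 : ℝ) • (k / n : ℝ) + (1 / 2 : ℝ) • ((k + 1 + 1 : ℕ) / n : ℝ)
      = ((k + 1 : ℕ) / n : ℝ) := by
    push_cast; simp only [smul_eq_mul]; ring
  rw [h2] at h1
  simp only [smul_eq_mul] at h1
  linarith

/-- The expression is `n x - k` clipped to `[0, 1]`. -/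
lemma grid_hat_mem {n : ℕ} (hn : 0 < n) (k : ℕ) (x : ℝ) :
    (n * min x ((k + 1 : ℕ) / n) - n * min x (k / n) : ℝ) ∈ Icc (0 : ℝ) 1 := by
  have hn' : (0 : ℝ) < n := by exact_mod_cast hn
  rw [mul_min_of_nonneg _ _ hn'.le, mul_min_of_nonneg _ _ hn'.le, mul_div_cancel₀ _ hn'.ne',
    mul_div_cancel₀ _ hn'.ne']
  push_cast
  constructor
  · have := min_le_min_left (n * x : ℝ) (show (k : ℝ) ≤ k + 1 by linarith)
    linarith
  · rcases le_total (n * x : ℝ) k with h1 | h1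
    · rw [min_eq_left h1, min_eq_left (by linarith)]; linarith
    · rw [min_eq_right h1]; linarith [min_le_right (n * x : ℝ) (k + 1)]

lemma gridInterp_mem (hh : MonotoneOn h (Icc 0 1)) {n : ℕ} (hn : 0 < n) (x : ℝ) :
    gridInterp h n x ∈ Icc 0 (h 1 - h 0) := by
  constructor
  · exact Finset.sum_nonneg fun k hk => mul_nonneg
      (grid_increment_nonneg hh (Finset.mem_range.1 hk)) (grid_hat_mem hn k x).1
  · have : gridInterp h n x ≤ ∑ k ∈ Finset.range n, (h ((k + 1 : ℕ) / n) - h (k / n)) :=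
      Finset.sum_le_sum fun k hk => mul_le_of_le_one_right
        (grid_increment_nonneg hh (Finset.mem_range.1 hk)) (grid_hat_mem hn k x).2
    refine this.trans_eq ?_
    rw [Finset.sum_range_sub (fun k : ℕ => h (k / n : ℝ))]
    have hn' : (n : ℝ) ≠ 0 := by exact_mod_cast hn.ne'
    simp [div_self hn']

/-- To the right of `j / n` the first `j` ramps are all 1, so their terms telescope; the others are
nonnegative. -/
lemma le_gridInterp (hh : MonotoneOn h (Icc 0 1)) {n j : ℕ} (hn : 0 < n) (hj : j ≤ n) {x : ℝ}
    (hx : (j / n : ℝ) ≤ x) : h (j / n) - h 0 ≤ gridInterp h n x := by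
  have hn' : (0 : ℝ) < n := by exact_mod_cast hn
  have h1 := Finset.sum_range_sub (fun k : ℕ => h (k / n : ℝ)) j
  simp only [Nat.cast_zero, zero_div] at h1
  rw [← h1]
  refine (Finset.sum_le_sum fun k hk => ?_).trans
    (Finset.sum_le_sum_of_subset_of_nonneg (Finset.range_mono hj) fun k hk _ => mul_nonneg
      (grid_increment_nonneg hh (Finset.mem_range.1 hk)) (grid_hat_mem hn k x).1)
  have hkj := Finset.mem_range.1 hk
  have h2 : ((k + 1 : ℕ) / n : ℝ) ≤ x := le_trans (by gcongr; exact hkj) hx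
  have h3 : (k / n : ℝ) ≤ x := le_trans (by gcongr; simp) h2
  rw [min_eq_right h2, min_eq_right h3, mul_div_cancel₀ _ hn'.ne', mul_div_cancel₀ _ hn'.ne']
  push_cast
  linarith

lemma gridInterp_le (hh : MonotoneOn h (Icc 0 1)) {n j : ℕ} (hn : 0 < n) (hj : j ≤ n) {x : ℝ}
    (hx : x ≤ (j / n : ℝ)) : gridInterp h n x ≤ h (j / n) - h 0 := by
  have h1 := Finset.sum_range_sub (fun k : ℕ => h (k / n : ℝ)) j
  simp only [Nat.cast_zero, zero_div] at h1
  rw [← h1]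
  have h2 : gridInterp h n x = ∑ k ∈ Finset.range j, (h ((k + 1 : ℕ) / n) - h (k / n)) *
      (n * min x ((k + 1 : ℕ) / n) - n * min x (k / n)) := by
    refine (Finset.sum_subset (Finset.range_mono hj) fun k _ hk => ?_).symm
    have hkj : j ≤ k := not_lt.1 fun hlt => hk (Finset.mem_range.2 hlt)
    have h3 : x ≤ (k / n : ℝ) := hx.trans (by gcongr)
    have h4 : x ≤ ((k + 1 : ℕ) / n : ℝ) := h3.trans (by gcongr; simp)
    rw [min_eq_left h3, min_eq_left h4, sub_self, mul_zero]
  rw [h2]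
  exact Finset.sum_le_sum fun k hk => mul_le_of_le_one_right
    (grid_increment_nonneg hh ((Finset.mem_range.1 hk).trans_le hj)) (grid_hat_mem hn k x).2

/-- At an interior point `h` is continuous and the interpolant is squeezed between its values at the
neighbouring grid points. The endpoints are treated apart, since a concave `h` may jump at 0; they
are grid points, where the interpolant is exact. -/
lemma tendsto_gridInterp (hh : MonotoneOn h (Icc 0 1)) (hc : ConcaveOn ℝ (Icc 0 1) h) {x : ℝ}
    (hx : x ∈ Icc (0 : ℝ) 1) :
    Tendsto (fun n : ℕ => gridInterp h (n + 1) x) atTop (𝓝 (h x - h 0)) := by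
  rcases hx.1.eq_or_lt with rfl | h0
  · refine tendsto_const_nhds.congr fun n => ?_
    have h1 := le_gridInterp hh n.succ_pos (Nat.zero_le _) (x := 0) (by simp)
    have h2 := gridInterp_le hh n.succ_pos (Nat.zero_le _) (x := 0) (by simp)
    simp only [Nat.cast_zero, zero_div] at h1 h2
    exact le_antisymm h1 h2
  rcases hx.2.eq_or_lt with rfl | hx1
  · refine tendsto_const_nhds.congr fun n => ?_
    have h3 : (((n + 1 : ℕ) : ℝ) / (n + 1 : ℕ)) = 1 := div_self (by positivity)
    have h1 := le_gridInterp hh n.succ_pos le_rfl (x := 1) h3.le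
    have h2 := gridInterp_le hh n.succ_pos le_rfl (x := 1) h3.ge
    rw [h3] at h1 h2
    exact le_antisymm h1 h2
  have hcont : ContinuousAt h x := by
    have h1 : ContinuousOn h (Ioo 0 1) :=
      (hc.subset Ioo_subset_Icc_self (convex_Ioo 0 1)).continuousOn isOpen_Ioo
    exact h1.continuousAt (isOpen_Ioo.mem_nhds ⟨h0, hx1⟩)
  have hfl : Tendsto (fun n : ℕ => (⌊x * n⌋₊ / n : ℝ)) atTop (𝓝 x) :=
    (tendsto_nat_floor_mul_div_atTop h0.le).comp tendsto_natCast_atTop_atTop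
  have hfl' : Tendsto (fun n : ℕ => ((⌊x * n⌋₊ + 1 : ℕ) / n : ℝ)) atTop (𝓝 x) := by
    have := hfl.add tendsto_one_div_atTop_nhds_zero_nat
    rw [add_zero] at this
    refine this.congr fun n => ?_
    push_cast; ring
  have hs := tendsto_add_atTop_nat 1
  refine tendsto_of_tendsto_of_tendsto_of_le_of_le
    (((hcont.tendsto.comp hfl).comp hs).sub_const (h 0))
    (((hcont.tendsto.comp hfl').comp hs).sub_const (h 0)) (fun n => ?_) (fun n => ?_)
  · have hn : (0 : ℝ) < (n + 1 : ℕ) := by positivity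
    have h1 : (⌊x * (n + 1 : ℕ)⌋₊ : ℝ) ≤ x * (n + 1 : ℕ) := Nat.floor_le (by positivity)
    refine le_gridInterp hh n.succ_pos ?_ ((div_le_iff₀ hn).2 h1)
    have h2 : (⌊x * (n + 1 : ℕ)⌋₊ : ℝ) ≤ (n + 1 : ℕ) :=
      h1.trans (mul_le_of_le_one_left hn.le hx1.le)
    exact_mod_cast h2
  · have hn : (0 : ℝ) < (n + 1 : ℕ) := by positivity
    refine gridInterp_le hh n.succ_pos ?_ ((le_div_iff₀ hn).2 ?_)
    · refine Nat.succ_le_of_lt ((Nat.floor_lt (by positivity)).2 ?_)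
      exact mul_lt_of_lt_one_left hn hx1
    · push_cast
      have := (Nat.lt_floor_add_one (x * (n + 1 : ℕ))).le
      push_cast at this
      exact this

/-- Summation by parts: all coefficients of the `D k` become nonnegative when `d` is nonnegative and
decreasing. -/
lemma abel_sum_nonpos {d D : ℕ → ℝ} {n : ℕ} (hd : ∀ k < n, 0 ≤ d k)
    (hd' : ∀ k, k + 1 < n → d (k + 1) ≤ d k) (hD0 : D 0 = 0) (hD : ∀ k, D k ≤ 0) :
    ∑ k ∈ Finset.range n, d k * (D (k + 1) - D k) ≤ 0 := by
  have key : ∀ N, N < n → ∑ k ∈ Finset.range (N + 1), d k * (D (k + 1) - D k) ≤ d N * D (N + 1) := by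
    intro N
    induction N with
    | zero => intro _; simp [hD0]
    | succ N ih =>
      intro hN
      rw [Finset.sum_range_succ]
      nlinarith [ih (by omega), mul_le_mul_of_nonpos_right (hd' N hN) (hD (N + 1))]
  rcases n with _ | n
  · simp
  · exact (key n (by omega)).trans (mul_nonpos_of_nonneg_of_nonpos (hd n (by omega)) (hD _))

end Interpolation

/-! ### A concave distortion gives risk aversion and quasi-convexity. -/

section Concave

variable {Ω : Type*} [MeasurableSpace Ω] {P : Measure Ω} [IsProbabilityMeasure P]

lemma intervalIntegrable_min_survival (X : Ω → ℝ) (α a b : ℝ) :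
    IntervalIntegrable (fun x => min (survival P X x) α) volume a b :=
  intervalIntegrable_comp_survival (monotoneOn_min α _) X a b

lemma integral_gridInterp_survival (h : ℝ → ℝ) (n : ℕ) (X : Ω → ℝ) (m M : ℝ) :
    ∫ x in m..M, gridInterp h n (survival P X x)
      = ∑ k ∈ Finset.range n, (h ((k + 1 : ℕ) / n) - h (k / n)) *
        (n * (∫ x in m..M, min (survival P X x) ((k + 1 : ℕ) / n))
          - n * ∫ x in m..M, min (survival P X x) (k / n)) := by
  have hi := fun α => (intervalIntegrable_min_survival (P := P) X α m M).const_mul (n : ℝ)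
  unfold gridInterp
  rw [intervalIntegral.integral_finsetSum fun k _ => ((hi _).sub (hi _)).const_mul _]
  refine Finset.sum_congr rfl fun k _ => ?_
  rw [intervalIntegral.integral_const_mul, intervalIntegral.integral_sub (hi _) (hi _),
    intervalIntegral.integral_const_mul, intervalIntegral.integral_const_mul]

lemma tendsto_integral_gridInterp {h : ℝ → ℝ} (hh : IsDistortionFunction h)
    (hc : ConcaveOn ℝ (Icc 0 1) h) (X : Ω → ℝ) (m M : ℝ) :
    Tendsto (fun n : ℕ => ∫ x in m..M, gridInterp h (n + 1) (survival P X x)) atTop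
      (𝓝 (∫ x in m..M, h (survival P X x))) := by
  refine intervalIntegral.tendsto_integral_filter_of_dominated_convergence (fun _ => 1)
    (Eventually.of_forall fun n => ?_) (Eventually.of_forall fun n => ?_)
    intervalIntegrable_const (Eventually.of_forall fun x _ => ?_)
  · have hg : Measurable (gridInterp h (n + 1)) := by unfold gridInterp; fun_prop
    exact (hg.comp (survival_antitone X).measurable).aestronglyMeasurable
  · refine Eventually.of_forall fun x _ => ?_
    have := gridInterp_mem hh.mono n.succ_pos (survival P X x)
    rw [hh.one, hh.zero, sub_zero] at this
    rw [Real.norm_eq_abs, abs_of_nonneg this.1]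
    exact this.2
  · simpa [hh.zero] using tendsto_gridInterp hh.mono hc (survival_mem (P := P) X x)

/-- One statement serves two purposes: `t = 1` gives monotonicity in the increasing convex order,
and `W = t X + (1 - t) Y` gives convexity. -/
lemma integral_concave_survival_le_combination {h : ℝ → ℝ} (hh : IsDistortionFunction h)
    (hconc : ConcaveOn ℝ (Icc 0 1) h) {W X Y : Ω → ℝ} (hW : Measurable W) (hX : Measurable X)
    (hY : Measurable Y) {m M : ℝ} (hmM : m ≤ M) (hW' : ∀ ω, W ω ∈ Icc m M)
    (hX' : ∀ ω, X ω ∈ Icc m M) (hY' : ∀ ω, Y ω ∈ Icc m M) {t : ℝ} (ht : t ∈ Icc (0 : ℝ) 1)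
    (hle : ∀ c d : ℝ, ∫ ω, max (W ω - (t * c + (1 - t) * d)) 0 ∂P
      ≤ t * ∫ ω, max (X ω - c) 0 ∂P + (1 - t) * ∫ ω, max (Y ω - d) 0 ∂P) :
    ∫ x in m..M, h (survival P W x) ≤ t * (∫ x in m..M, h (survival P X x))
      + (1 - t) * ∫ x in m..M, h (survival P Y x) := by
  refine le_of_tendsto_of_tendsto' (tendsto_integral_gridInterp hh hconc W m M)
    (((tendsto_integral_gridInterp hh hconc X m M).const_mul t).add
      ((tendsto_integral_gridInterp hh hconc Y m M).const_mul (1 - t))) fun n => ?_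
  simp only [integral_gridInterp_survival]
  rw [← sub_nonpos, Finset.mul_sum, Finset.mul_sum, ← Finset.sum_add_distrib,
    ← Finset.sum_sub_distrib]
  -- `D k` is the scaled defect of the inequality at truncation level `k / (n + 1)`. The goal is the
  -- Abel sum of these defects against the grid increments of `h`.
  set D : ℕ → ℝ := fun k => ((n + 1 : ℕ) : ℝ) *
    ((∫ x in m..M, min (survival P W x) (k / (n + 1 : ℕ)))
      - (t * (∫ x in m..M, min (survival P X x) (k / (n + 1 : ℕ)))
      + (1 - t) * ∫ x in m..M, min (survival P Y x) (k / (n + 1 : ℕ)))) with hDdef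
  have hz : ∀ V : Ω → ℝ, ∫ x in m..M, min (survival P V x) 0 = 0 := fun V => by
    simp [min_eq_right (survival_mem (P := P) V _).1]
  have hD0 : D 0 = 0 := by simp [hDdef, hz]
  have hD : ∀ k, D k ≤ 0 := fun k => mul_nonpos_of_nonneg_of_nonpos (by positivity)
    (sub_nonpos.2 (integral_min_survival_le_combination hW hX hY hmM hW' hX' hY' ht hle
      (by positivity)))
  refine le_trans (le_of_eq (Finset.sum_congr rfl fun k _ => ?_))
    (abel_sum_nonpos (n := n + 1)
      (d := fun k : ℕ => h ((k + 1 : ℕ) / (n + 1 : ℕ)) - h (k / (n + 1 : ℕ)))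
      (fun k hk => grid_increment_nonneg hh.mono hk)
      (fun k hk => grid_increment_antitone hconc hk) hD0 hD)
  simp only [hDdef]
  ring

lemma exists_common_bound {X Y : Ω → ℝ} (hX : X ∈ BoundedRV Ω) (hY : Y ∈ BoundedRV Ω) :
    ∃ C : ℝ, 0 ≤ C ∧ (∀ ω, X ω ∈ Icc (-C) C) ∧ ∀ ω, Y ω ∈ Icc (-C) C := by
  obtain ⟨-, C, hC⟩ := hX
  obtain ⟨-, D, hD⟩ := hY
  refine ⟨max (max C D) 0, le_max_right _ _, fun ω => abs_le.1 ?_, fun ω => abs_le.1 ?_⟩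
  · exact (hC ω).trans ((le_max_left _ _).trans (le_max_left _ _))
  · exact (hD ω).trans ((le_max_right _ _).trans (le_max_left _ _))

lemma boundedRV_of_mem_Icc {X : Ω → ℝ} (hX : Measurable X) {C : ℝ} (h : ∀ ω, X ω ∈ Icc (-C) C) :
    X ∈ BoundedRV Ω := ⟨hX, C, fun ω => abs_le.2 (h ω)⟩

lemma lossSpace_subset_boundedRV : LossSpace Ω ⊆ BoundedRV Ω := fun _ hX =>
  boundedRV_of_mem_Icc hX.1 (C := 1) fun ω => ⟨by linarith [(hX.2 ω).1], (hX.2 ω).2⟩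

lemma IsDistortionRiskMeasure.eq_integral {h : ℝ → ℝ} {ρ : (Ω → ℝ) → ℝ}
    (hρ : IsDistortionRiskMeasure P h ρ) {X : Ω → ℝ} (hX : Measurable X) {C : ℝ} (hC : 0 ≤ C)
    (hX' : ∀ ω, X ω ∈ Icc (-C) C) : ρ X = -C + ∫ x in (-C)..C, h (survival P X x) := by
  rw [hρ.eq_choquet X (boundedRV_of_mem_Icc hX hX'),
    choquetIntegral_eq hρ.isDistortion (by linarith) hC hX']

lemma IsDistortionRiskMeasure.eq_integral_of_mem_lossSpace {h : ℝ → ℝ} {ρ : (Ω → ℝ) → ℝ}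
    (hρ : IsDistortionRiskMeasure P h ρ) {X : Ω → ℝ} (hX : X ∈ LossSpace Ω) :
    ρ X = ∫ x in (0)..1, h (survival P X x) := by
  rw [hρ.eq_choquet X (lossSpace_subset_boundedRV hX),
    choquetIntegral_eq hρ.isDistortion le_rfl zero_le_one hX.2, zero_add]

theorem IsDistortionRiskMeasure.ra_of_concaveOn {h : ℝ → ℝ} {ρ : (Ω → ℝ) → ℝ}
    (hρ : IsDistortionRiskMeasure P h ρ) (hc : ConcaveOn ℝ (Icc 0 1) h) :
    RA P (BoundedRV Ω) ρ := by
  intro X hX Y hY hXY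
  obtain ⟨C, hC, hXC, hYC⟩ := exists_common_bound hX hY
  rw [hρ.eq_integral hX.1 hC hXC, hρ.eq_integral hY.1 hC hYC]
  -- With `t = 1` the third variable has weight 0 and only fills a slot.
  have := integral_concave_survival_le_combination (P := P) hρ.isDistortion hc hX.1 hY.1 hY.1
    (by linarith) hXC hYC hYC (t := 1) (by simp) fun c d => by
      have h1 := hXY (fun x => max (x - c) 0)
        (fun x y hxy => max_le_max_right 0 (sub_le_sub_right hxy c))
        (ConvexOn.sup (ConvexOn.sub (convexOn_id convex_univ) (concaveOn_const c convex_univ))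
          (convexOn_const 0 convex_univ))
      simpa using h1
  simpa using this

theorem IsDistortionRiskMeasure.qc_of_concaveOn {h : ℝ → ℝ} {ρ : (Ω → ℝ) → ℝ}
    (hρ : IsDistortionRiskMeasure P h ρ) (hc : ConcaveOn ℝ (Icc 0 1) h) :
    QC (BoundedRV Ω) ρ := by
  intro X hX Y hY t ht
  obtain ⟨C, hC, hXC, hYC⟩ := exists_common_bound hX hY
  have ht' : 0 ≤ 1 - t := sub_nonneg.2 ht.2
  have hWm : Measurable fun ω => t * X ω + (1 - t) * Y ω :=
    (hX.1.const_mul t).add (hY.1.const_mul (1 - t))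
  have hW : ∀ ω, t * X ω + (1 - t) * Y ω ∈ Icc (-C) C := fun ω =>
    (convex_Icc (-C) C) (hXC ω) (hYC ω) ht.1 ht' (by ring)
  have key := integral_concave_survival_le_combination (P := P) hρ.isDistortion hc hWm hX.1 hY.1
    (by linarith) hW hXC hYC ht fun c d => by
      rw [← integral_const_mul, ← integral_const_mul, ← integral_add
        ((integrable_max_sub hX.1 hXC c).const_mul t)
        ((integrable_max_sub hY.1 hYC d).const_mul (1 - t))]
      refine integral_mono (integrable_max_sub hWm hW _)
        (((integrable_max_sub hX.1 hXC c).const_mul t).add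
          ((integrable_max_sub hY.1 hYC d).const_mul (1 - t))) fun ω => ?_
      have h1 := mul_le_mul_of_nonneg_left (le_max_left (X ω - c) 0) ht.1
      have h2 := mul_le_mul_of_nonneg_left (le_max_left (Y ω - d) 0) ht'
      have h3 := mul_nonneg ht.1 (le_max_right (X ω - c) 0)
      have h4 := mul_nonneg ht' (le_max_right (Y ω - d) 0)
      exact max_le (by linarith) (by linarith)
  rw [hρ.eq_integral hWm hC hW, hρ.eq_integral hX.1 hC hXC, hρ.eq_integral hY.1 hC hYC]
  set a := ∫ x in (-C)..C, h (survival P X x)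
  set b := ∫ x in (-C)..C, h (survival P Y x)
  have h1 := mul_le_mul_of_nonneg_left (le_max_left (-C + a) (-C + b)) ht.1
  have h2 := mul_le_mul_of_nonneg_left (le_max_right (-C + a) (-C + b)) ht'
  linarith

end Concave

/-! ### Intermediate values and independent events on atomless spaces. -/

section Atomless

variable {Ω : Type*} [MeasurableSpace Ω] {P : Measure Ω} [IsFiniteMeasure P]

/-- Of `B` and its complement in `A`, one has at most half the measure. -/
lemma Atomless.exists_subset_le_half (hP : Atomless P) {A : Set Ω} (hA : MeasurableSet A)
    (hpos : 0 < P A) : ∃ B ⊆ A, MeasurableSet B ∧ 0 < P B ∧ P B ≤ P A / 2 := by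
  obtain ⟨B, hBA, hB, hB0, hlt⟩ := hP A hA hpos
  have hd : P (A \ B) = P A - P B := measure_sdiff hBA hB.nullMeasurableSet (measure_ne_top P B)
  rcases le_total (P B) (P A / 2) with h | h
  · exact ⟨B, hBA, hB, hB0, h⟩
  · refine ⟨A \ B, sdiff_subset, hA.diff hB, ?_, ?_⟩
    · rw [hd]; exact tsub_pos_of_lt hlt
    · rw [hd, tsub_le_iff_left]
      calc P A = P A / 2 + P A / 2 := (ENNReal.add_halves _).symm
        _ ≤ P B + P A / 2 := by gcongr

lemma Atomless.exists_subset_le (hP : Atomless P) {A : Set Ω} (hA : MeasurableSet A)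
    (hpos : 0 < P A) {ε : ℝ≥0∞} (hε : 0 < ε) :
    ∃ B ⊆ A, MeasurableSet B ∧ 0 < P B ∧ P B ≤ ε := by
  have key : ∀ n : ℕ, ∃ B ⊆ A, MeasurableSet B ∧ 0 < P B ∧ P B ≤ P A * (2⁻¹) ^ n := by
    intro n
    induction n with
    | zero => exact ⟨A, Subset.rfl, hA, hpos, by simp⟩
    | succ n ih =>
      obtain ⟨B, hBA, hB, hB0, hle⟩ := ih
      obtain ⟨C, hCB, hC, hC0, hle'⟩ := hP.exists_subset_le_half hB hB0
      refine ⟨C, hCB.trans hBA, hC, hC0, hle'.trans ?_⟩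
      rw [pow_succ, ← mul_assoc, ENNReal.div_eq_inv_mul, mul_comm]
      gcongr
  have hlim : Tendsto (fun n : ℕ => P A * (2⁻¹ : ℝ≥0∞) ^ n) atTop (𝓝 0) := by
    have := ENNReal.Tendsto.const_mul (a := P A)
      (ENNReal.tendsto_pow_atTop_nhds_zero_of_lt_one (r := 2⁻¹) (by simp))
      (Or.inr (measure_ne_top P A))
    simpa using this
  obtain ⟨n, hn⟩ := (hlim.eventually (gt_mem_nhds hε)).exists
  obtain ⟨B, hBA, hB, hB0, hle⟩ := key n
  exact ⟨B, hBA, hB, hB0, hle.trans hn.le⟩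

/-- Sierpiński's theorem: an atomless finite measure takes all intermediate values. -/
theorem Atomless.exists_subset_measure_eq (hP : Atomless P) {A : Set Ω} (hA : MeasurableSet A)
    {t : ℝ≥0∞} (ht : t ≤ P A) : ∃ B ⊆ A, MeasurableSet B ∧ P B = t := by
  have httop : t ≠ ∞ := ne_top_of_le_ne_top (measure_ne_top P A) ht
  let S : Type _ := {B : Set Ω // B ⊆ A ∧ MeasurableSet B ∧ P B ≤ t}
  let cand : S → Set (Set Ω) := fun B => {C | C ⊆ A \ B.1 ∧ MeasurableSet C ∧ P C ≤ t - P B.1}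
  -- Greedy choice: add a set of at least half the largest measure that still fits below `t`.
  have hstep : ∀ B : S, ∃ C ∈ cand B, ∀ D ∈ cand B, P D / 2 ≤ P C := by
    intro B
    set s := ⨆ D : cand B, P D.1 with hs
    rcases eq_or_ne s 0 with h0 | h0
    · refine ⟨∅, ⟨empty_subset _, MeasurableSet.empty, by simp⟩, fun D hD => ?_⟩
      have : P D ≤ s := le_iSup (fun D : cand B => P D.1) ⟨D, hD⟩
      simp [le_antisymm (this.trans_eq h0) zero_le]
    · have hs_fin : s ≠ ∞ := ne_top_of_le_ne_top httop (iSup_le fun D => D.2.2.2.trans tsub_le_self)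
      obtain ⟨C, hC⟩ := lt_iSup_iff.1 (hs ▸ ENNReal.half_lt_self h0 hs_fin)
      refine ⟨C.1, C.2, fun D hD => le_trans ?_ hC.le⟩
      gcongr
      exact le_iSup (fun D : cand B => P D.1) ⟨D, hD⟩
  choose C hC hCmax using hstep
  let next : S → S := fun B => ⟨B.1 ∪ C B, union_subset B.2.1 ((hC B).1.trans sdiff_subset),
    B.2.2.1.union (hC B).2.1, (measure_union_le _ _).trans
      ((add_le_add_right (hC B).2.2 _).trans_eq (add_tsub_cancel_of_le B.2.2.2))⟩
  let seq : ℕ → S := fun n => next^[n] ⟨∅, empty_subset _, MeasurableSet.empty, by simp⟩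
  have hseq : ∀ n, (seq (n + 1)).1 = (seq n).1 ∪ C (seq n) := fun n => by
    simp only [seq, Function.iterate_succ_apply', next]
  have hmono : Monotone fun n => (seq n).1 := monotone_nat_of_le_succ fun n => by
    rw [hseq]; exact subset_union_left
  set B := ⋃ n, (seq n).1 with hB
  have hBA : B ⊆ A := iUnion_subset fun n => (seq n).2.1
  have hBm : MeasurableSet B := MeasurableSet.iUnion fun n => (seq n).2.2.1
  have hBt : P B ≤ t := by
    rw [hB, hmono.measure_iUnion]
    exact iSup_le fun n => (seq n).2.2.2
  refine ⟨B, hBA, hBm, hBt.antisymm (not_lt.1 fun hlt => ?_)⟩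
  have hd : P (A \ B) = P A - P B := measure_sdiff hBA hBm.nullMeasurableSet (measure_ne_top P B)
  obtain ⟨D, hDA, hD, hD0, hDle⟩ := hP.exists_subset_le (hA.diff hBm)
    (hd ▸ tsub_pos_of_lt (hlt.trans_le ht)) (tsub_pos_of_lt hlt)
  -- If the union fell short of `t`, a small `D` left over would have been a candidate at every
  -- stage. Each stage would then have added at least `P D / 2 > 0`, eventually exceeding `t`.
  have hDn : ∀ n, P D / 2 ≤ P (C (seq n)) := fun n => hCmax _ D
    ⟨hDA.trans (sdiff_subset_sdiff_right (subset_iUnion (fun n => (seq n).1) n)), hD,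
      hDle.trans (tsub_le_tsub_left (measure_mono (subset_iUnion (fun n => (seq n).1) n)) _)⟩
  have hgrow : ∀ n : ℕ, n * (P D / 2) ≤ P (seq n).1 := by
    intro n
    induction n with
    | zero => simp
    | succ n ih =>
      rw [hseq, measure_union (disjoint_sdiff_right.mono_right (hC (seq n)).1) (hC (seq n)).2.1]
      push_cast
      rw [add_mul, one_mul]
      exact add_le_add ih (hDn n)
  obtain ⟨n, hn⟩ := ENNReal.exists_nat_mul_gt (ENNReal.half_pos hD0.ne').ne' httop
  exact absurd ((hgrow n).trans (seq n).2.2.2) (not_le.2 hn)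

/-- An atomless measure can be thinned by any factor on all fibers of a discrete random variable. -/
lemma Atomless.exists_measure_inter_preimage_eq (hP : Atomless P) {g : Ω → ℕ} (hg : Measurable g)
    {p : ℝ≥0∞} (hp : p ≤ 1) :
    ∃ E, MeasurableSet E ∧ ∀ T : Set ℕ, P (E ∩ g ⁻¹' T) = p * P (g ⁻¹' T) := by
  have hfib : ∀ k, MeasurableSet (g ⁻¹' {k}) := fun k => hg (measurableSet_singleton k)
  have : ∀ k, ∃ B ⊆ g ⁻¹' {k}, MeasurableSet B ∧ P B = p * P (g ⁻¹' {k}) := fun k =>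
    hP.exists_subset_measure_eq (hfib k) (mul_le_of_le_one_left zero_le hp)
  choose B hBsub hBm hBP using this
  have hE : MeasurableSet (⋃ k, B k) := MeasurableSet.iUnion hBm
  refine ⟨⋃ k, B k, hE, ?_⟩
  -- The two measures live on `ℕ`, so agreement on singletons, that is fibre by fibre, is enough.
  have hmeas : (P.restrict (⋃ k, B k)).map g = p • P.map g := by
    refine Measure.ext_of_singleton fun k => ?_
    rw [Measure.map_apply hg (measurableSet_singleton k), Measure.restrict_apply (hfib k),
      Measure.smul_apply, Measure.map_apply hg (measurableSet_singleton k), smul_eq_mul, ← hBP]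
    congr 1
    ext ω
    simp only [mem_inter_iff, mem_preimage, mem_singleton_iff, mem_iUnion]
    constructor
    · rintro ⟨rfl, j, hj⟩
      have hgj : g ω = j := hBsub j hj
      rwa [hgj]
    · exact fun h => ⟨hBsub k h, k, h⟩
  intro T
  have hT : MeasurableSet T := MeasurableSet.of_discrete
  have := congrArg (fun μ => μ T) hmeas
  simp only [Measure.smul_apply, Measure.map_apply hg hT, Measure.restrict_apply (hg hT),
    smul_eq_mul] at this
  rw [inter_comm, this]

end Atomless

/-- On an atomless probability space there are independent events of any given probabilities. -/
theorem Atomless.exists_iIndepSet {Ω : Type*} [MeasurableSpace Ω] {P : Measure Ω}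
    [IsProbabilityMeasure P] (hP : Atomless P) {p : ℕ → ℝ≥0∞} (hp : ∀ n, p n ≤ 1) :
    ∃ E : ℕ → Set Ω, (∀ n, MeasurableSet (E n)) ∧ (∀ n, P (E n) = p n) ∧ iIndepSet E P := by
  classical
  choose F hFm hF using fun (g : {g : Ω → ℕ // Measurable g}) n =>
    hP.exists_measure_inter_preimage_eq g.2 (hp n)
  -- `hist n` encodes in binary which of the first `n` events occurred. Thinning each of its fibres
  -- by `p n` makes the next event independent of that history.
  let hist : ℕ → {g : Ω → ℕ // Measurable g} := fun n =>
    Nat.rec ⟨fun _ => 0, measurable_const⟩ (fun n g => ⟨fun ω => 2 * g.1 ω +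
      (F g n).indicator (fun _ => 1) ω,
        (g.2.const_mul 2).add (measurable_const.indicator (hFm g n))⟩) n
  let E : ℕ → Set Ω := fun n => F (hist n) n
  have hhist : ∀ n ω, (hist (n + 1)).1 ω = 2 * (hist n).1 ω + (E n).indicator (fun _ => 1) ω :=
    fun n ω => rfl
  have hEm : ∀ n, MeasurableSet (E n) := fun n => hFm _ _
  have hEP : ∀ n, P (E n) = p n := fun n => by
    have := hF (hist n) n univ
    simpa using this
  have hind_le : ∀ n ω, (E n).indicator (fun _ => 1) ω ≤ (1 : ℕ) := fun n ω => by
    by_cases h : ω ∈ E n <;> simp [h]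
  have hdet : ∀ n (s : Finset ℕ), (∀ i ∈ s, i < n) →
      ∃ T : Set ℕ, ⋂ i ∈ s, E i = (hist n).1 ⁻¹' T := by
    intro n
    induction n with
    | zero =>
      intro s hs
      have : s = ∅ := Finset.eq_empty_of_forall_notMem fun i hi => absurd (hs i hi) (by omega)
      exact ⟨univ, by simp [this]⟩
    | succ n ih =>
      intro s hs
      obtain ⟨T, hT⟩ := ih (s.erase n) fun i hi => by
        have := hs i (Finset.mem_of_mem_erase hi)
        have := Finset.ne_of_mem_erase hi
        omega
      have hdiv : ∀ ω, (hist (n + 1)).1 ω / 2 = (hist n).1 ω := fun ω => by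
        rw [hhist]
        by_cases h : ω ∈ E n
        · simp only [h, indicator_of_mem]; omega
        · simp [h]
      have hT' : ∀ ω, ω ∈ (⋂ i ∈ s.erase n, E i) ↔ (hist (n + 1)).1 ω / 2 ∈ T := fun ω => by
        rw [hT, hdiv]; rfl
      by_cases hn : n ∈ s
      -- The last binary digit records `E n`; the quotient by 2 is the earlier history.
      · refine ⟨{k | k / 2 ∈ T ∧ k % 2 = 1}, ?_⟩
        ext ω
        rw [← Finset.insert_erase hn, Finset.set_biInter_insert]
        have hmod : ω ∈ E n ↔ (hist (n + 1)).1 ω % 2 = 1 := by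
          rw [hhist]
          by_cases h : ω ∈ E n <;> simp [h]
        rw [mem_inter_iff, hT', hmod, and_comm]
        rfl
      · refine ⟨{k | k / 2 ∈ T}, ?_⟩
        ext ω
        rw [← Finset.erase_eq_of_notMem hn, hT']
        rfl
  refine ⟨E, hEm, hEP, (iIndepSet_iff_meas_biInter hEm).2 fun s => ?_⟩
  -- Adding the largest index last leaves an intersection of earlier events, which `hist m`
  -- determines.
  induction s using Finset.induction_on_max with
  | empty => simp
  | insert m s hs ih =>
    have hms : m ∉ s := fun h => lt_irrefl _ (hs m h)
    obtain ⟨T, hT⟩ := hdet m s hs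
    rw [Finset.set_biInter_insert, Finset.prod_insert hms, ← ih, hT, hEP]
    exact hF (hist m) m T

lemma poolLoss_apply_fin {Ω : Type*} (L : ℕ → Ω → ℝ) (n : ℕ) (ω : Ω) :
    poolLoss L n ω = (∑ i : Fin n, L i ω) / n := by
  rw [poolLoss, Finset.sum_range]

lemma seniorTranche_zero {Ω : Type*} {X : Ω → ℝ} (hX : ∀ ω, 0 ≤ X ω) : seniorTranche X 0 = X := by
  funext ω
  simp [seniorTranche, hX ω]

/-! ### Exchangeability and the effect of enlarging a pool. -/

section Exchangeable

variable {Ω : Type*} {m : MeasurableSpace Ω} [mΩ : MeasurableSpace Ω] {P : Measure Ω}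

/-- The right-hand side does not involve `σ`; this is what yields exchangeability. -/
lemma CondIIDGiven.measureReal_iInter [IsProbabilityMeasure P] {L : ℕ → Ω → ℝ}
    (hL : CondIIDGiven P m L) (hm : m ≤ mΩ) {n : ℕ} {σ : Fin n → ℕ}
    (hσ : Function.Injective σ) (hLm : ∀ i, Measurable (L i)) {B : Fin n → Set ℝ}
    (hB : ∀ i, MeasurableSet (B i)) :
    P.real (⋂ i, L (σ i) ⁻¹' B i) = ∫ ω, ∏ i, (P⟦L 0 ⁻¹' B i | m⟧) ω ∂P := by
  -- The factorization takes a set for every index; those outside the range of `σ` receive `univ`.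
  have hB' : ∀ j, MeasurableSet (Function.extend σ B (fun _ => univ) j) := by
    intro j
    by_cases h : ∃ i, σ i = j
    · obtain ⟨i, rfl⟩ := h
      rw [hσ.extend_apply]; exact hB i
    · rw [Function.extend_apply' _ _ _ h]; exact MeasurableSet.univ
  have h1 := hL.indep (Finset.univ.map ⟨σ, hσ⟩) _ hB'
  have h2 : (⋂ j ∈ Finset.univ.map ⟨σ, hσ⟩, L j ⁻¹' Function.extend σ B (fun _ => univ) j)
      = ⋂ i, L (σ i) ⁻¹' B i := by
    ext ω
    simp [hσ.extend_apply]
  have h3 : (∏ j ∈ Finset.univ.map ⟨σ, hσ⟩,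
      P⟦L j ⁻¹' Function.extend σ B (fun _ => univ) j | m⟧)
      = ∏ i, P⟦L (σ i) ⁻¹' B i | m⟧ := by
    rw [Finset.prod_map]
    exact Finset.prod_congr rfl fun i _ => by simp [hσ.extend_apply]
  rw [h2, h3] at h1
  have hmeas : MeasurableSet (⋂ i, L (σ i) ⁻¹' B i) :=
    MeasurableSet.iInter fun i => hLm _ (hB i)
  have h4 : P.real (⋂ i, L (σ i) ⁻¹' B i) = ∫ ω, (P⟦⋂ i, L (σ i) ⁻¹' B i | m⟧) ω ∂P := by
    rw [integral_condExp hm]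
    exact (integral_indicator_one hmeas).symm
  rw [h4]
  refine integral_congr_ae ?_
  have h5 : ∀ᵐ ω ∂P, ∀ i, (P⟦L (σ i) ⁻¹' B i | m⟧) ω = (P⟦L 0 ⁻¹' B i | m⟧) ω :=
    ae_all_iff.2 fun i => hL.identDistrib (σ i) 0 (B i) (hB i)
  filter_upwards [h1, h5] with ω hω hω'
  rw [hω, Finset.prod_apply]
  exact Finset.prod_congr rfl fun i _ => hω' i

/-- A conditionally iid sequence is exchangeable. -/
lemma CondIIDGiven.map_eq [IsProbabilityMeasure P] {L : ℕ → Ω → ℝ}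
    (hL : CondIIDGiven P m L)
    (hm : m ≤ mΩ) (hLm : ∀ i, Measurable (L i)) {n : ℕ} {σ τ : Fin n → ℕ}
    (hσ : Function.Injective σ) (hτ : Function.Injective τ) :
    P.map (fun ω i => L (σ i) ω) = P.map (fun ω i => L (τ i) ω) := by
  have hmeas : ∀ υ : Fin n → ℕ, Measurable (fun ω i => L (υ i) ω) := fun υ =>
    measurable_pi_iff.2 fun i => hLm _
  have := Measure.isProbabilityMeasure_map (μ := P) (hmeas σ).aemeasurable
  refine ext_of_generate_finite _ generateFrom_pi.symm isPiSystem_pi ?_ ?_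
  · rintro _ ⟨B, hB, rfl⟩
    have hB' : ∀ i, MeasurableSet (B i) := fun i => hB i (mem_univ i)
    have hset : ∀ υ : Fin n → ℕ, (fun ω i => L (υ i) ω) ⁻¹' univ.pi B = ⋂ i, L (υ i) ⁻¹' B i := by
      intro υ; ext ω; simp
    rw [Measure.map_apply (hmeas σ) (MeasurableSet.univ_pi hB'),
      Measure.map_apply (hmeas τ) (MeasurableSet.univ_pi hB'), hset, hset,
      ← measureReal_eq_measureReal_iff, hL.measureReal_iInter hm hσ hLm hB',
      hL.measureReal_iInter hm hτ hLm hB']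
  · rw [Measure.map_apply (hmeas σ) MeasurableSet.univ,
      Measure.map_apply (hmeas τ) MeasurableSet.univ]
    simp

lemma mean_mem_Icc {n : ℕ} {x : Fin n → ℝ} (hx : ∀ i, x i ∈ Icc (0 : ℝ) 1) :
    (∑ i, x i) / n ∈ Icc (0 : ℝ) 1 := by
  refine ⟨div_nonneg (Finset.sum_nonneg fun i _ => (hx i).1) (by positivity),
    div_le_one_of_le₀ ?_ (by positivity)⟩
  simpa using Finset.sum_le_sum fun i (_ : i ∈ Finset.univ) => (hx i).2

lemma poolLoss_mem_lossSpace {L : ℕ → Ω → ℝ} (hL : ∀ i, L i ∈ LossSpace Ω) (n : ℕ) :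
    poolLoss L n ∈ LossSpace Ω := by
  refine ⟨(Finset.measurable_sum _ fun i _ => (hL i).1).div_const _, fun ω => ?_⟩
  rw [poolLoss_apply_fin]
  exact mean_mem_Icc fun i => (hL i).2 ω

lemma integrable_monotone_comp [IsProbabilityMeasure P] {ψ : ℝ → ℝ} (hψ : Monotone ψ) {X : Ω → ℝ}
    (hX : X ∈ LossSpace Ω) : Integrable (fun ω => ψ (X ω)) P :=
  Integrable.of_bound (C := max |ψ 0| |ψ 1|) (hψ.measurable.comp hX.1).aestronglyMeasurable
    (Eventually.of_forall fun ω => abs_le_max_abs_abs (hψ (hX.2 ω).1) (hψ (hX.2 ω).2))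

/-- Enlarging a conditionally iid pool decreases it in the increasing convex order. -/
lemma CondIID.icxLE_poolLoss_succ [IsProbabilityMeasure P] {L : ℕ → Ω → ℝ} (hL : ∀ i, L i ∈ LossSpace Ω)
    (hc : CondIID P L) {n : ℕ} (hn : 1 ≤ n) : IcxLE P (poolLoss L (n + 1)) (poolLoss L n) := by
  obtain ⟨d, Z, hZ, hc⟩ := hc
  intro ψ hψ hψc
  have hn' : (n : ℝ) ≠ 0 := by positivity
  -- Leave-one-out means: `Y j` averages the first `n + 1` losses except the `j`-th.
  let Y : Fin (n + 1) → Ω → ℝ := fun j ω => (∑ i : Fin n, L (j.succAbove i) ω) / n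
  have hY : ∀ j, Y j ∈ LossSpace Ω := fun j =>
    ⟨(Finset.measurable_sum _ fun i _ => (hL _).1).div_const _,
      fun ω => mean_mem_Icc fun i => (hL _).2 ω⟩
  have hYint : ∀ j, ∫ ω, ψ (Y j ω) ∂P = ∫ ω, ψ (poolLoss L n ω) ∂P := by
    intro j
    have hmap := hc.map_eq hZ.comap_le (fun i => (hL i).1) (n := n)
      (σ := fun i => (j.succAbove i : ℕ)) (τ := fun i => (i : ℕ))
      (Fin.val_injective.comp Fin.succAbove_right_injective) Fin.val_injective
    have hmeas : ∀ υ : Fin n → ℕ, Measurable (fun ω i => L (υ i) ω) := fun υ =>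
      measurable_pi_iff.2 fun i => (hL _).1
    have hg : AEStronglyMeasurable (fun x : Fin n → ℝ => ψ ((∑ i, x i) / n))
        (P.map fun ω (i : Fin n) => L i ω) :=
      (hψ.measurable.comp (by fun_prop)).aestronglyMeasurable
    simp only [poolLoss_apply_fin]
    have h1 := integral_map (hmeas fun i => (i : ℕ)).aemeasurable hg
    have h2 := integral_map (hmeas fun i => (j.succAbove i : ℕ)).aemeasurable (hmap ▸ hg)
    rw [← h1, ← hmap, h2]
  have hpool : ∀ ω, poolLoss L (n + 1) ω = ∑ j, (1 / (n + 1 : ℝ)) • Y j ω := by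
    intro ω
    have h1 : ∀ j, Y j ω = ((∑ i : Fin (n + 1), L i ω) - L j ω) / n := fun j => by
      rw [Fin.sum_univ_succAbove (fun i : Fin (n + 1) => L i ω) j, add_sub_cancel_left]
    simp only [h1, smul_eq_mul, ← Finset.mul_sum, ← Finset.sum_div, Finset.sum_sub_distrib,
      Finset.sum_const, Finset.card_univ, Fintype.card_fin, poolLoss_apply_fin]
    push_cast
    simp only [nsmul_eq_mul]
    push_cast
    field_simp
    ring
  calc ∫ ω, ψ (poolLoss L (n + 1) ω) ∂P
      ≤ ∫ ω, ∑ j, 1 / (n + 1 : ℝ) * ψ (Y j ω) ∂P := by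
        refine integral_mono (integrable_monotone_comp hψ (poolLoss_mem_lossSpace hL _))
          (integrable_finsetSum _ fun j _ => (integrable_monotone_comp hψ (hY j)).const_mul _)
          fun ω => ?_
        simp only [hpool]
        refine hψc.map_sum_le (fun _ _ => by positivity) ?_ fun _ _ => mem_univ _
        simp only [Finset.sum_const, Finset.card_univ, Fintype.card_fin, nsmul_eq_mul]
        push_cast
        field_simp
    _ = ∫ ω, ψ (poolLoss L n ω) ∂P := by
        rw [integral_finsetSum _ fun j _ => (integrable_monotone_comp hψ (hY j)).const_mul _]
        simp only [integral_const_mul, hYint, Finset.sum_const, Finset.card_univ, Fintype.card_fin,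
          nsmul_eq_mul]
        push_cast
        field_simp

lemma CondIID.icxLE_poolLoss [IsProbabilityMeasure P] {L : ℕ → Ω → ℝ} (hL : ∀ i, L i ∈ LossSpace Ω)
    (hc : CondIID P L) {n n' : ℕ} (hn : 1 ≤ n) (hnn' : n ≤ n') :
    IcxLE P (poolLoss L n') (poolLoss L n) := by
  intro ψ hψ hψc
  induction n', hnn' using Nat.le_induction with
  | base => exact le_rfl
  | succ k hk ih => exact (hc.icxLE_poolLoss_succ hL (hn.trans hk) ψ hψ hψc).trans ih

lemma seniorTranche_mem_lossSpace {X : Ω → ℝ} (hX : X ∈ LossSpace Ω) {K : ℝ}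
    (hK : K ∈ Ico (0 : ℝ) 1) : seniorTranche X K ∈ LossSpace Ω := by
  have hK' : 0 < 1 - K := sub_pos.2 hK.2
  refine ⟨((hX.1.sub_const K).max measurable_const).div_const _, fun ω =>
    ⟨div_nonneg (le_max_right _ _) hK'.le, (div_le_one hK').2 (max_le ?_ hK'.le)⟩⟩
  linarith [(hX.2 ω).2]

lemma IcxLE.seniorTranche {X Y : Ω → ℝ} (hXY : IcxLE P X Y) {K : ℝ} (hK : K < 1) :
    IcxLE P (seniorTranche X K) (seniorTranche Y K) := by
  intro φ hφ hφc
  have hK' : 0 < 1 - K := sub_pos.2 hK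
  have hm : Monotone fun x : ℝ => max (x - K) 0 / (1 - K) := fun x y hxy =>
    div_le_div_of_nonneg_right (max_le_max_right 0 (sub_le_sub_right hxy K)) hK'.le
  have hc : ConvexOn ℝ univ fun x : ℝ => max (x - K) 0 / (1 - K) := by
    have h1 : ConvexOn ℝ univ fun x : ℝ => max (x - K) 0 :=
      ConvexOn.sup (ConvexOn.sub (convexOn_id convex_univ) (concaveOn_const K convex_univ))
        (convexOn_const 0 convex_univ)
    have h2 := h1.smul (inv_nonneg.2 hK'.le)
    refine h2.congr fun x _ => ?_
    simp only [smul_eq_mul]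
    rw [div_eq_inv_mul]
  refine hXY (fun x => φ (max (x - K) 0 / (1 - K))) (hφ.comp hm) ?_
  refine ⟨convex_univ, fun x _ y _ a b ha hb hab => ?_⟩
  exact (hφ (hc.2 (mem_univ x) (mem_univ y) ha hb hab)).trans
    (hφc.2 (mem_univ _) (mem_univ _) ha hb hab)

theorem pe_of_ra [IsProbabilityMeasure P] {ρ : (Ω → ℝ) → ℝ} (h : RA P (LossSpace Ω) ρ) : PE P ρ :=
  fun _ hK _ hL hc n n' hn hnn' =>
    h _ (seniorTranche_mem_lossSpace (poolLoss_mem_lossSpace hL n') hK)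
      _ (seniorTranche_mem_lossSpace (poolLoss_mem_lossSpace hL n) hK)
      ((hc.icxLE_poolLoss hL hn hnn').seniorTranche hK.2)

lemma PEStar.poolLoss_le {ρ : (Ω → ℝ) → ℝ} (h : PEStar P ρ) {L : ℕ → Ω → ℝ}
    (hL : ∀ i, L i ∈ LossSpace Ω) (hc : CondIID P L) {n : ℕ} (hn : 1 ≤ n) :
    ρ (poolLoss L n) ≤ ρ (L 0) := by
  have h1 := h L hL hc 1 n le_rfl hn
  have h2 : poolLoss L 1 = L 0 := by funext ω; simp [poolLoss]
  rwa [seniorTranche_zero fun ω => ((poolLoss_mem_lossSpace hL n).2 ω).1,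
    seniorTranche_zero fun ω => ((poolLoss_mem_lossSpace hL 1).2 ω).1, h2] at h1

/-- The running mean is a convex combination of the previous mean and the next loss, with weights `n
/ (n + 1)` and `1 / (n + 1)`. Equal individual risks suffice here. -/
lemma QC.poolLoss_le {ρ : (Ω → ℝ) → ℝ} (h : QC (LossSpace Ω) ρ) {L : ℕ → Ω → ℝ}
    (hL : ∀ i, L i ∈ LossSpace Ω) (hρL : ∀ i, ρ (L i) = ρ (L 0)) {n : ℕ} (hn : 1 ≤ n) :
    ρ (poolLoss L n) ≤ ρ (L 0) := by
  induction n, hn using Nat.le_induction with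
  | base =>
    have h2 : poolLoss L 1 = L 0 := by funext ω; simp [poolLoss]
    rw [h2]
  | succ n hn ih =>
    have hn' : (n : ℝ) ≠ 0 := by positivity
    have h1 := h _ (poolLoss_mem_lossSpace hL n) _ (hL n) (n / (n + 1 : ℝ))
      ⟨by positivity, div_le_one_of_le₀ (by linarith) (by positivity)⟩
    have h2 : poolLoss L (n + 1) = fun ω => (n / (n + 1 : ℝ)) * poolLoss L n ω
        + (1 - n / (n + 1 : ℝ)) * L n ω := by
      funext ω
      simp only [poolLoss, Finset.sum_range_succ]
      push_cast
      field_simp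
      ring
    rw [h2]
    exact h1.trans (max_le ih (hρL n).le)

end Exchangeable

/-! ### Conditionally iid sequences built from independent variables. -/

section Construction

variable {Ω : Type*} [mΩ : MeasurableSpace Ω] {P : Measure Ω}

lemma iIndepFun_indepFun_head_tail {V : ℕ → Ω → ℝ} (hV : iIndepFun V P)
    (hVm : ∀ i, Measurable (V i)) (d : ℕ) :
    IndepFun (fun ω (k : Fin d) => V k ω) (fun ω i => V (i + d) ω) P := by
  have h1 := indep_iSup_of_disjoint (fun i => (hVm i).comap_le) hV.iIndep
    (S := {i | i < d}) (T := {i | d ≤ i})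
    (disjoint_left.2 fun i (hi : i < d) (hi' : d ≤ i) => absurd hi' (not_le.2 hi))
  rw [IndepFun_iff_Indep]
  refine indep_of_indep_of_le_left (indep_of_indep_of_le_right h1 ?_) ?_
  · simp only [MeasurableSpace.pi, MeasurableSpace.comap_iSup, MeasurableSpace.comap_comp]
    exact iSup_le fun i => le_iSup₂_of_le (i + d) (Nat.le_add_left d i) le_rfl
  · simp only [MeasurableSpace.pi, MeasurableSpace.comap_iSup, MeasurableSpace.comap_comp]
    exact iSup_le fun k => le_iSup₂_of_le (k : ℕ) k.2 le_rfl

variable [IsProbabilityMeasure P]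

/-- The tail `W` is independent of the head `Z`, so its conditional law is the constant product law:
freeze `Z` and compute the measure of a box. -/
lemma condExp_iInter_preimage_of_iIndepFun {V : ℕ → Ω → ℝ} (hV : iIndepFun V P)
    (hVm : ∀ i, Measurable (V i)) {d : ℕ} (hid : ∀ i, P.map (V (i + d)) = P.map (V d))
    {f : (Fin d → ℝ) → ℝ → ℝ} (hf : Measurable (Function.uncurry f)) (s : Finset ℕ)
    {B : ℕ → Set ℝ} (hB : ∀ i, MeasurableSet (B i)) :
    P⟦⋂ i ∈ s, (fun ω => f (fun k => V k ω) (V (i + d) ω)) ⁻¹' B i |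
        MeasurableSpace.comap (fun ω (k : Fin d) => V k ω) inferInstance⟧
      =ᵐ[P] fun ω => ∏ i ∈ s, (P.map (V d)).real {y | f (fun k => V k ω) y ∈ B i} := by
  set Z : Ω → Fin d → ℝ := fun ω k => V k ω
  set W : Ω → ℕ → ℝ := fun ω i => V (i + d) ω
  have hZ : Measurable Z := measurable_pi_iff.2 fun k => hVm k
  have hW : Measurable W := measurable_pi_iff.2 fun i => hVm _
  have hprob : IsProbabilityMeasure (P.map (V d)) :=
    Measure.isProbabilityMeasure_map (hVm d).aemeasurable
  have hprobW : IsProbabilityMeasure (P.map W) := Measure.isProbabilityMeasure_map hW.aemeasurable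
  have hlaw : P.map W = Measure.infinitePi fun _ => P.map (V d) := by
    have h1 := (hV.precomp (add_left_injective d)).map_fun_eq_infinitePi_map fun i => hVm _
    refine h1.trans ?_
    congr 1
    funext i
    exact hid i
  have hcond : condDistrib W Z P =ᵐ[P.map Z] Kernel.const _ (P.map W) := by
    refine condDistrib_ae_eq_of_measure_eq_compProd Z hW.aemeasurable ?_
    rw [Measure.compProd_const]
    exact (indepFun_iff_map_prod_eq_prod_map_map hZ.aemeasurable hW.aemeasurable).1
      (iIndepFun_indepFun_head_tail hV hVm d)
  let A : Set ((Fin d → ℝ) × (ℕ → ℝ)) := {x | ∀ i ∈ s, f x.1 (x.2 i) ∈ B i}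
  have hA : MeasurableSet A := by
    have : A = ⋂ i ∈ s, (fun x : (Fin d → ℝ) × (ℕ → ℝ) => f x.1 (x.2 i)) ⁻¹' B i := by
      ext x; simp [A]
    rw [this]
    refine Finset.measurableSet_biInter s fun i _ => ?_
    have hm : Measurable fun x : (Fin d → ℝ) × (ℕ → ℝ) => (x.1, x.2 i) := by fun_prop
    exact (hf.comp hm) (hB i)
  have hpre : ((⋂ i ∈ s, (fun ω => f (Z ω) (V (i + d) ω)) ⁻¹' B i).indicator fun _ => (1 : ℝ))
      = fun ω => A.indicator (fun _ => (1 : ℝ)) (Z ω, W ω) := by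
    funext ω
    by_cases h : ω ∈ ⋂ i ∈ s, (fun ω => f (Z ω) (V (i + d) ω)) ⁻¹' B i
    · have h' : (Z ω, W ω) ∈ A := fun i hi => mem_iInter₂.1 h i hi
      rw [indicator_of_mem h, indicator_of_mem h']
    · have h' : (Z ω, W ω) ∉ A := fun h' => h (mem_iInter₂.2 fun i hi => h' i hi)
      rw [indicator_of_notMem h, indicator_of_notMem h']
  have hint : Integrable (fun ω => A.indicator (fun _ => (1 : ℝ)) (Z ω, W ω)) P := by
    refine Integrable.of_bound (C := 1)
      ((measurable_const.indicator hA).comp (hZ.prodMk hW)).aestronglyMeasurable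
      (Eventually.of_forall fun ω => ?_)
    by_cases h : (Z ω, W ω) ∈ A <;> simp [h]
  have h1 := condExp_prod_ae_eq_integral_condDistrib (μ := P) hZ hW.aemeasurable
    (stronglyMeasurable_const.indicator hA) hint
  rw [hpre]
  filter_upwards [h1, ae_of_ae_map hZ.aemeasurable hcond] with ω hω hω'
  rw [hω, hω', Kernel.const_apply, hlaw]
  have hmt : ∀ i ∈ s, MeasurableSet {y | f (Z ω) y ∈ B i} := fun i _ =>
    (hf.comp measurable_prodMk_left) (hB i)
  have hset : (fun y => A.indicator (fun _ => (1 : ℝ)) (Z ω, y))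
      = (Set.pi (s : Set ℕ) fun i => {y | f (Z ω) y ∈ B i}).indicator 1 := by
    funext y
    by_cases h : (Z ω, y) ∈ A
    · have h' : y ∈ Set.pi (s : Set ℕ) fun i => {y | f (Z ω) y ∈ B i} := fun i hi => h i hi
      rw [indicator_of_mem h, indicator_of_mem h', Pi.one_apply]
    · have h' : y ∉ Set.pi (s : Set ℕ) fun i => {y | f (Z ω) y ∈ B i} :=
        fun h' => h fun i hi => h' i hi
      rw [indicator_of_notMem h, indicator_of_notMem h']
  rw [hset, integral_indicator_one (MeasurableSet.pi s.countable_toSet hmt), measureReal_def,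
    Measure.infinitePi_pi _ hmt, ENNReal.toReal_prod]
  rfl

/-- A sequence `f (Z, W i)` with `W` iid and independent of the vector `Z` is conditionally iid. -/
lemma condIID_of_iIndepFun {V : ℕ → Ω → ℝ} (hV : iIndepFun V P)
    (hVm : ∀ i, Measurable (V i)) {d : ℕ} (hid : ∀ i, P.map (V (i + d)) = P.map (V d))
    {f : (Fin d → ℝ) → ℝ → ℝ} (hf : Measurable (Function.uncurry f)) :
    CondIID P fun i ω => f (fun k => V k ω) (V (i + d) ω) := by
  refine ⟨d, fun ω k => V k ω, measurable_pi_iff.2 fun k => hVm k, ?_⟩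
  have hsingle : ∀ (i : ℕ) (B : Set ℝ), MeasurableSet B →
      P⟦(fun ω => f (fun k => V k ω) (V (i + d) ω)) ⁻¹' B |
        MeasurableSpace.comap (fun ω (k : Fin d) => V k ω) inferInstance⟧
      =ᵐ[P] fun ω => (P.map (V d)).real {y | f (fun k => V k ω) y ∈ B} := fun i B hB => by
    simpa using condExp_iInter_preimage_of_iIndepFun hV hVm hid hf {i} (B := fun _ => B) fun _ => hB
  refine ⟨fun s B hB => ?_, fun i j B hB => (hsingle i B hB).trans (hsingle j B hB).symm⟩
  have h2 : ∀ᵐ ω ∂P, ∀ i, (P⟦(fun ω => f (fun k => V k ω) (V (i + d) ω)) ⁻¹' B i |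
        MeasurableSpace.comap (fun ω (k : Fin d) => V k ω) inferInstance⟧) ω
      = (P.map (V d)).real {y | f (fun k => V k ω) y ∈ B i} :=
    ae_all_iff.2 fun i => hsingle i (B i) (hB i)
  filter_upwards [condExp_iInter_preimage_of_iIndepFun hV hVm hid hf s hB, h2] with ω h1 h2
  rw [h1, Finset.prod_apply]
  exact Finset.prod_congr rfl fun i _ => (h2 i).symm

end Construction

/-! ### Indicators of independent events. -/

section Bernoulli

variable {Ω : Type*} [mΩ : MeasurableSpace Ω] {P : Measure Ω} [IsProbabilityMeasure P]

lemma map_indicator_one_congr {A B : Set Ω} (hA : MeasurableSet A) (hB : MeasurableSet B)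
    (hAB : P A = P B) :
    P.map (A.indicator fun _ => (1 : ℝ)) = P.map (B.indicator fun _ => (1 : ℝ)) := by
  classical
  ext S hS
  rw [Measure.map_apply (measurable_const.indicator hA) hS,
    Measure.map_apply (measurable_const.indicator hB) hS,
    indicator_const_preimage_eq_union, indicator_const_preimage_eq_union]
  have hc : P Aᶜ = P Bᶜ := by
    rw [prob_compl_eq_one_sub hA, prob_compl_eq_one_sub hB, hAB]
  by_cases h1 : (1 : ℝ) ∈ S <;> by_cases h0 : (0 : ℝ) ∈ S <;> simp [h0, h1, hAB, hc]

/-- The relative frequencies of independent events of equal probability converge. -/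
lemma tendsto_mean_indicator {E : ℕ → Set Ω} (hE : ∀ n, MeasurableSet (E n))
    (hind : iIndepSet E P) (hP : ∀ n, P (E n) = P (E 0)) :
    ∀ᵐ ω ∂P, Tendsto (fun n : ℕ =>
      (∑ i ∈ Finset.range n, (E i).indicator (fun _ => (1 : ℝ)) ω) / n) atTop
      (𝓝 (P.real (E 0))) := by
  have hm : ∀ i, Measurable ((E i).indicator fun _ => (1 : ℝ)) := fun i =>
    measurable_const.indicator (hE i)
  have h := strong_law_ae_real (μ := P) (fun i => (E i).indicator fun _ => (1 : ℝ))
    ((integrable_const 1).indicator (hE 0))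
    (fun i j hij => hind.iIndepFun_indicator.indepFun hij)
    fun i => ⟨(hm i).aemeasurable, (hm 0).aemeasurable,
      map_indicator_one_congr (hE i) (hE 0) (hP i)⟩
  have h2 : ∫ ω, (E 0).indicator (fun _ => (1 : ℝ)) ω ∂P = P.real (E 0) :=
    integral_indicator_one (hE 0)
  rwa [h2] at h

lemma iIndepSet_measureReal_union_inter {E : ℕ → Set Ω} (hE : ∀ n, MeasurableSet (E n))
    (hind : iIndepSet E P) {i j k : ℕ} (hij : i ≠ j) (hik : i ≠ k) (hjk : j ≠ k) :
    P.real (E i ∪ E j ∩ E k) = P.real (E i) + P.real (E j) * P.real (E k)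
      - P.real (E i) * (P.real (E j) * P.real (E k)) := by
  have h1 := measureReal_union_add_inter (μ := P) (s := E i) ((hE j).inter (hE k))
  have h2 : P.real (E j ∩ E k) = P.real (E j) * P.real (E k) := by
    have := hind.meas_biInter {j, k}
    simp [hjk] at this
    simp [measureReal_def, this]
  have h3 : P.real (E i ∩ (E j ∩ E k)) = P.real (E i) * (P.real (E j) * P.real (E k)) := by
    have := hind.meas_biInter {i, j, k}
    simp [hij, hik, hjk] at this
    simp [measureReal_def, this]
  linarith

lemma iIndepSet_measureReal_union {E : ℕ → Set Ω} (hE : ∀ n, MeasurableSet (E n))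
    (hind : iIndepSet E P) {i j : ℕ} (hij : i ≠ j) :
    P.real (E i ∪ E j) = P.real (E i) + P.real (E j) - P.real (E i) * P.real (E j) := by
  have h1 := measureReal_union_add_inter (μ := P) (s := E i) (hE j)
  have h2 : P.real (E i ∩ E j) = P.real (E i) * P.real (E j) := by
    have := hind.meas_biInter {i, j}
    simp [hij] at this
    simp [measureReal_def, this]
  linarith

end Bernoulli

/-! ### The three-state example and the necessity of concavity. -/

/-- The loss at level `w` in the medium state, `1` in the bad state and `0` in the good state. -/
def stateLoss (z : Fin 2 → ℝ) (w : ℝ) : ℝ := z 0 + (1 - z 0) * z 1 * w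

lemma measurable_uncurry_stateLoss : Measurable (Function.uncurry stateLoss) := by
  unfold Function.uncurry stateLoss
  fun_prop

section StateLoss

variable {Ω : Type*}

lemma stateLoss_indicator_mem (A B : Set Ω) {w : ℝ} (hw : w ∈ Icc (0 : ℝ) 1) (ω : Ω)
    {z : Fin 2 → ℝ} (h0 : z 0 = A.indicator (fun _ => 1) ω)
    (h1 : z 1 = B.indicator (fun _ => 1) ω) : stateLoss z w ∈ Icc (0 : ℝ) 1 := by
  obtain ⟨hw0, hw1⟩ := hw
  by_cases hA : ω ∈ A <;> by_cases hB : ω ∈ B <;> simp [stateLoss, h0, h1, hA, hB, hw0, hw1]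

lemma lt_stateLoss_iff (A B : Set Ω) {w x : ℝ} (hx : x ∈ Ico (0 : ℝ) 1) (ω : Ω)
    {z : Fin 2 → ℝ} (h0 : z 0 = A.indicator (fun _ => 1) ω)
    (h1 : z 1 = B.indicator (fun _ => 1) ω) :
    x < stateLoss z w ↔ ω ∈ A ∨ (ω ∈ B ∧ x < w) := by
  by_cases hA : ω ∈ A <;> by_cases hB : ω ∈ B <;>
    simp [stateLoss, h0, h1, hA, hB, hx.1, hx.2]

end StateLoss

variable {Ω : Type*} [mΩ : MeasurableSpace Ω] {P : Measure Ω} [IsProbabilityMeasure P]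

/-- The equal-risk premise inside `H` lets quasi-convexity supply `H` as well as [PE*]. -/
lemma le_of_poolLoss_le (hP : Atomless P) {h : ℝ → ℝ} {ρ : (Ω → ℝ) → ℝ}
    (hρ : IsDistortionRiskMeasure P h ρ) (hLS : LowerSemicontAS P (LossSpace Ω) ρ)
    (H : ∀ L : ℕ → Ω → ℝ, (∀ i, L i ∈ LossSpace Ω) → CondIID P L → (∀ i, ρ (L i) = ρ (L 0)) →
      ∀ n, 1 ≤ n → ρ (poolLoss L n) ≤ ρ (L 0))
    {a b p : ℝ} (ha : 0 ≤ a) (hab : a ≤ b) (hb : b ≤ 1) (hp : p ∈ Icc (0 : ℝ) 1) :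
    p * h b + (1 - p) * h a ≤ h (p * b + (1 - p) * a) := by
  -- `q` makes `E 0 ∪ E 1` have probability `a + (1 - a) q = b`. If `a = 1`, the division returns 0,
  -- which is right because then `b = 1` too.
  set q := (b - a) / (1 - a) with hq
  have hq0 : 0 ≤ q := div_nonneg (by linarith) (by linarith)
  have hq1 : q ≤ 1 := div_le_one_of_le₀ (by linarith) (by linarith)
  have haq : (1 - a) * q = b - a := by
    rcases eq_or_ne (1 - a) 0 with h0 | h0
    · rw [h0, zero_mul]; linarith
    · rw [hq, mul_div_cancel₀ _ h0]
  -- `E 0` is the bad state, `E 1` outside `E 0` the medium one, and `E (i + 2)` the default of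
  -- asset `i` in the medium state.
  let π : ℕ → ℝ := fun n => if n = 0 then a else if n = 1 then q else p
  have hπ : ∀ n, 0 ≤ π n ∧ π n ≤ 1 := fun n => by
    simp only [π]
    split_ifs
    exacts [⟨ha, hab.trans hb⟩, ⟨hq0, hq1⟩, hp]
  obtain ⟨E, hE, hEP, hind⟩ := hP.exists_iIndepSet (p := fun n => ENNReal.ofReal (π n))
    fun n => ENNReal.ofReal_le_one.2 (hπ n).2
  have hEr : ∀ n, P.real (E n) = π n := fun n => by
    rw [measureReal_def, hEP, ENNReal.toReal_ofReal (hπ n).1]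
  have hπ0 : π 0 = a := rfl
  have hπ1 : π 1 = q := rfl
  have hπ2 : ∀ i, π (i + 2) = p := fun i => rfl
  let V : ℕ → Ω → ℝ := fun i => (E i).indicator fun _ => 1
  have hVm : ∀ i, Measurable (V i) := fun i => measurable_const.indicator (hE i)
  let L : ℕ → Ω → ℝ := fun i ω => stateLoss (fun k => V k ω) (V (i + 2) ω)
  let Y : Ω → ℝ := fun ω => stateLoss (fun k => V k ω) p
  have hZm : Measurable fun ω (k : Fin 2) => V k ω := measurable_pi_iff.2 fun k => hVm k
  have hL : ∀ i, L i ∈ LossSpace Ω := fun i =>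
    ⟨measurable_uncurry_stateLoss.comp (hZm.prodMk (hVm (i + 2))), fun ω =>
      stateLoss_indicator_mem (E 0) (E 1)
        (by by_cases hω : ω ∈ E (i + 2) <;> simp [V, hω]) ω rfl rfl⟩
  have hY : Y ∈ LossSpace Ω :=
    ⟨measurable_uncurry_stateLoss.comp (hZm.prodMk measurable_const), fun ω =>
      stateLoss_indicator_mem (E 0) (E 1) hp ω rfl rfl⟩
  have hcL : CondIID P L := condIID_of_iIndepFun hind.iIndepFun_indicator hVm
    (fun i => map_indicator_one_congr (hE _) (hE _) (by rw [hEP, hEP, hπ2, hπ2 0]))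
    measurable_uncurry_stateLoss
  have hρL : ∀ i, ρ (L i) = h (p * b + (1 - p) * a) := by
    intro i
    rw [hρ.eq_integral_of_mem_lossSpace (hL i), intervalIntegral.integral_of_le zero_le_one,
      ← integral_Ico_eq_integral_Ioc]
    -- `L i` takes only the values 0 and 1, so its survival function is constant on `[0, 1)`.
    have hsurv : ∀ x ∈ Ico (0 : ℝ) 1, h (survival P (L i) x) = h (p * b + (1 - p) * a) := by
      intro x hx
      have hset : {ω | x < L i ω} = E 0 ∪ E 1 ∩ E (i + 2) := by
        ext ω
        refine (lt_stateLoss_iff (E 0) (E 1) hx ω rfl rfl).trans ?_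
        by_cases hω : ω ∈ E (i + 2) <;> simp [V, hω, hx.2, hx.1]
      rw [survival, hset, iIndepSet_measureReal_union_inter hE hind (by omega) (by omega) (by omega),
        hEr, hEr, hEr, hπ0, hπ1, hπ2]
      congr 1
      linear_combination p * haq
    rw [setIntegral_congr_fun measurableSet_Ico hsurv]
    simp
  have hρY : ρ Y = p * h b + (1 - p) * h a := by
    have hi := fun c d => intervalIntegrable_comp_survival (P := P) hρ.isDistortion.mono Y c d
    rw [hρ.eq_integral_of_mem_lossSpace hY,
      ← intervalIntegral.integral_add_adjacent_intervals (hi 0 p) (hi p 1),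
      intervalIntegral.integral_of_le hp.1, intervalIntegral.integral_of_le hp.2,
      ← integral_Ico_eq_integral_Ioc, ← integral_Ico_eq_integral_Ioc]
    have h1 : ∀ x ∈ Ico 0 p, h (survival P Y x) = h b := by
      intro x hx
      have hset : {ω | x < Y ω} = E 0 ∪ E 1 := by
        ext ω
        refine (lt_stateLoss_iff (E 0) (E 1) ⟨hx.1, hx.2.trans_le hp.2⟩ ω rfl rfl).trans ?_
        simp [hx.2]
      rw [survival, hset, iIndepSet_measureReal_union hE hind (by omega), hEr, hEr, hπ0, hπ1]
      congr 1
      linear_combination haq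
    have h2 : ∀ x ∈ Ico p 1, h (survival P Y x) = h a := by
      intro x hx
      have hset : {ω | x < Y ω} = E 0 := by
        ext ω
        refine (lt_stateLoss_iff (E 0) (E 1) ⟨hp.1.trans hx.1, hx.2⟩ ω rfl rfl).trans ?_
        simp [not_lt.2 hx.1]
      rw [survival, hset, hEr, hπ0]
    rw [setIntegral_congr_fun measurableSet_Ico h1, setIntegral_congr_fun measurableSet_Ico h2]
    simp [hp.1, hp.2]
  -- `stateLoss` is affine in the level, so averaging passes inside it. The shift to `n + 1`
  -- excludes the empty pool.
  have hpool : ∀ (n : ℕ) ω, poolLoss L (n + 1) ω = stateLoss (fun k => V k ω)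
      ((∑ i ∈ Finset.range (n + 1), V (i + 2) ω) / (n + 1 : ℕ)) := by
    intro n ω
    simp only [poolLoss, L, stateLoss, Finset.sum_add_distrib, ← Finset.mul_sum, Finset.sum_const,
      Finset.card_range, nsmul_eq_mul]
    field_simp
  have hlim : ∀ᵐ ω ∂P, Tendsto (fun n : ℕ => poolLoss L (n + 1) ω) atTop (𝓝 (Y ω)) := by
    have hslln := tendsto_mean_indicator (P := P) (E := fun i => E (i + 2)) (fun i => hE _)
      (hind.precomp (add_left_injective 2)) fun n => by rw [hEP, hEP, hπ2, hπ2 0]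
    filter_upwards [hslln] with ω hω
    rw [hEr, hπ2] at hω
    simp only [hpool]
    exact (((hω.comp (tendsto_add_atTop_nat 1)).const_mul _).const_add _)
  have hle := hLS (fun n => poolLoss L (n + 1)) Y (fun n => poolLoss_mem_lossSpace hL _) hY hlim
  -- Every pool has risk at most `ρ (L 0)`, hence so does the lower limit.
  have hle' : ((ρ Y : ℝ) : EReal) ≤ ((ρ (L 0) : ℝ) : EReal) := by
    refine hle.trans ((liminf_le_liminf (v := fun _ => ((ρ (L 0) : ℝ) : EReal))
      (Eventually.of_forall fun n => ?_)).trans_eq (liminf_const _))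
    exact EReal.coe_le_coe_iff.2 (H L hL hcL (fun i => by rw [hρL, hρL]) (n + 1) (by omega))
  rw [← hρY, ← hρL 0]
  exact EReal.coe_le_coe_iff.1 hle'

/-- If pooling never increases the risk, then the distortion function is concave. -/
theorem concaveOn_of_poolLoss_le (hP : Atomless P) {h : ℝ → ℝ} {ρ : (Ω → ℝ) → ℝ}
    (hρ : IsDistortionRiskMeasure P h ρ) (hLS : LowerSemicontAS P (LossSpace Ω) ρ)
    (H : ∀ L : ℕ → Ω → ℝ, (∀ i, L i ∈ LossSpace Ω) → CondIID P L → (∀ i, ρ (L i) = ρ (L 0)) →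
      ∀ n, 1 ≤ n → ρ (poolLoss L n) ≤ ρ (L 0)) :
    ConcaveOn ℝ (Icc 0 1) h := by
  refine ⟨convex_Icc 0 1, fun x hx y hy s t hs ht hst => ?_⟩
  simp only [smul_eq_mul]
  rcases le_total x y with hxy | hxy
  · have := le_of_poolLoss_le hP hρ hLS H hx.1 hxy hy.2 (p := t) ⟨ht, by linarith⟩
    rw [show 1 - t = s by linarith] at this
    rw [add_comm (s * x)]
    linarith
  · have := le_of_poolLoss_le hP hρ hLS H hy.1 hxy hx.2 (p := s) ⟨hs, by linarith⟩
    rwa [show 1 - s = t by linarith] at this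

end DistortionRisk

theorem corollary1 {Ω : Type*} [MeasurableSpace Ω] (P : Measure Ω) [IsProbabilityMeasure P]
    (hP : Atomless P) (h : ℝ → ℝ) (ρ : (Ω → ℝ) → ℝ) (hρ : IsDistortionRiskMeasure P h ρ)
    (hLS : LowerSemicontAS P (LossSpace Ω) ρ) :
    List.TFAE
      [PE P ρ,
       PEStar P ρ,
       RA P (LossSpace Ω) ρ,
       RA P (BoundedRV Ω) ρ,
       QC (LossSpace Ω) ρ,
       QC (BoundedRV Ω) ρ,
       ConcaveOn ℝ (Icc 0 1) h] := by
  tfae_have 7 → 4 := hρ.ra_of_concaveOn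
  tfae_have 4 → 3 := fun H X hX Y hY =>
    H X (lossSpace_subset_boundedRV hX) Y (lossSpace_subset_boundedRV hY)
  tfae_have 3 → 1 := pe_of_ra
  tfae_have 1 → 2 := fun H => H 0 (by simp)
  tfae_have 2 → 7 := fun H => concaveOn_of_poolLoss_le hP hρ hLS
    fun _ hL hc _ _ hn => H.poolLoss_le hL hc hn
  tfae_have 7 → 6 := hρ.qc_of_concaveOn
  tfae_have 6 → 5 := fun H X hX Y hY =>
    H X (lossSpace_subset_boundedRV hX) Y (lossSpace_subset_boundedRV hY)
  tfae_have 5 → 7 := fun H => concaveOn_of_poolLoss_le hP hρ hLS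
    fun _ hL _ hρL _ hn => H.poolLoss_le hL hρL hn
  tfae_finish
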